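/- **Setting.** Let $Y=X\beta^0+\sigma\epsilon\in\mathbb R^n$ with $\sigma\ge 0$, $\beta^0\in\mathbb R^p$, a nonrandom $X\in\mathbb R^{n\times p}$ such that all diagonal entries of $\Sigma=X'X/n$ equal $1$, and i.i.d. standard Gaussian $\epsilon_1,\dots,\epsilon_n$. Let $\{G_1,\dots,G_q\}$, $q\ge1$, be a partition of $\{1,\dots,p\}$ into nonempty groups, $T_j=|G_j|$, $T_{\min}=\min_jT_j$, $T_{\max}=\max_jT_j$. Write $\beta^j$ for the subvector of $\beta$ with indices in $G_j$, $X^j$ for the corresponding columns of $X$, $\zeta=\max_j\|X^j\|_{\mathrm{op}}^2/n$, $S=\{j:\beta^{0j}\ne0\}$, $s^*=\sum_{j\in S}T_j$. A Group Square-Root Lasso estimator $\widehat\beta$ with tuning parameter $\lambda$ is any minimizer over $\beta\in\mathbb R^p$ of $$\frac{\|Y-X\beta\|_2}{\sqrt n}+\frac{\lambda}{n}\sum_{j=1}^q\sqrt{T_j}\,\|\beta^j\|_2 .$$ Put $V=\max_j \sqrt n\,\|(X'\epsilon)^j\|_2/(\sqrt{T_j}\,\|\epsilon\|_2)$, $\overline\gamma=\frac{\gamma+1}{\gamma-1}$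 for $\gamma>1$, $\widetilde\eta=\frac{1+\eta}{1-\eta}$ for $0<\eta<1$. * $(\kappa,\gamma)\in C(X,S)$ means: $\kappa>0$, $\gamma>1$ and $\sum_{j\in S}\sqrt{T_j}\|\delta^j\|_2\le \sqrt{s^*}\,\|X\delta\|_2/(\sqrt n\,\kappa)$ for all $\delta\in\mathbb R^p$ with $\sum_{j\notin S}\sqrt{T_j}\|\delta^j\|_2\le\gamma\sum_{j\in S}\sqrt{T_j}\|\delta^j\|_2$. * Let $\Sigma_{1,1}=X_S'X_S/n$, $\Sigma_{2,1}=X_{S^c}'X_S/n$, where $X_S$, $X_{S^c}$ consist of the columns in the groups in, resp. outside, $S$. $\eta\in I(X,S)$ means: $0<\eta<1$, $\Sigma_{1,1}$ is invertible and $\|(\Sigma_{2,1}\Sigma_{1,1}^{-1}v)^j\|_2/\sqrt{T_j}<\eta$ for all $j\notin S$ and all $v\in\mathbb R^{s^*}$ with $\|v^k\|_2\le\sqrt{T_k}$ for every $k\in S$. Let $\xi=\max_v\max_{j\in S}\|(\Sigma_{1,1}^{-1}v)^j\|_\infty/\sqrt{T_j}$ over the same $v$ ($\xi=0$ if $S=\emptyset$).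 * $m\in B(\beta^0)$ means: $\|\beta^{0j}\|_\infty\ge m_j$ for all $j\in S$. Let $\alpha\in(0,1)$, $T_j<n$ for all $j$, and $16\log(2q/\alpha)\le n-T_{\max}$. For $c>0$ put $$\lambda_0(c)=\frac{\sqrt{2\zeta}\,n\,c}{\sqrt{n-T_{\max}}}\left(1+\sqrt{\frac{2\log(2q/\alpha)}{T_{\min}}}\right),$$ and put $t=\sqrt{4\log(1/\alpha)/n}+4\log(1/\alpha)/n$ and $u=2\gamma\big/\bigl(1-\tfrac{\lambda^2s^*}{n^2\kappa^2}\bigr)$. **Corollary 2.1.** One has $t\le 3/4$, and the following hold. (i) If $\gamma>1$ and $\lambda\ge\lambda_0(\overline\gamma)$, then $\mathbb P(V\le\lambda/\overline\gamma)\ge1-\alpha$. (ii) If $\gamma>1$, $0<\eta<1$ and $\lambda\ge\lambda_0(\overline\gamma\vee2\widetilde\eta)$, then $\mathbb P\bigl(V\le\lambda/(\overline\gamma\vee2\widetilde\eta)\bigr)\ge1-\alpha$. (iii) If $(\kappa,\gamma)\in C(X,S)$, $s^*<n^2\kappa^2/\lambda^2$ and $\lambda\ge\lambda_0(\overline\gamma)$,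 then estimators exist and, with probability at least $1-2\alpha$, every estimator $\widehat\beta$ satisfies $$\|X(\widehat\beta-\beta^0)\|_2\le\sqrt{1+t}\;u\,\frac{\sigma\lambda\sqrt{s^*}}{\kappa\sqrt n},\qquad \sum_{j=1}^q\sqrt{T_j}\,\|(\widehat\beta-\beta^0)^j\|_2\le(\gamma+1)\sqrt{1+t}\;u\,\frac{\sigma\lambda s^*}{\kappa^2n}.$$ (iv) If $(\kappa,\gamma)\in C(X,S)$, $\eta\in I(X,S)$, $s^*<n^2\kappa^2/\lambda^2$ and $\lambda\ge\lambda_0(\overline\gamma\vee2\widetilde\eta)$, then estimators exist and, with $D=2\sqrt{1+t}\,(1+u)\,\xi/(1+\eta)$, with probability at least $1-2\alpha$ every estimator $\widehat\beta$ satisfies: (1) $\widehat\beta^j=0$ for all $j\notin S$; (2) $\|(\widehat\beta-\beta^0)^j\|_\infty\le D\sqrt{T_j}\,\sigma\lambda/n$ for all $1\le j\le q$; (3) if there is $m\in B(\beta^0)$ with $m_j\ge D\sqrt{T_j}\,\sigma\lambda/n$ for all $j\in S$, then $\{j:\widehat\beta^j\ne0\}=S$. The smallest tuning parameters allowed in (iii)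 and (iv) are $O\bigl(\sqrt{n/T_{\min}}\,\log q\bigr)$ when $\zeta$, $n/(n-T_{\max})$ and $T_{\min}/\log^2q$ stay bounded (in particular for bounded group sizes): for every $M$ there is a constant $C$, depending only on $\alpha,\gamma,M$ (and on $\eta$ for the second bound), such that for all $n,p$, all $q\ge2$ and all designs and groups as above with $T_j<n$ for all $j$, $\zeta\le M$, $n\le M(n-T_{\max})$ and $T_{\min}\le M\log^2q$, $$\lambda_0(\overline\gamma)\le C\sqrt{\frac n{T_{\min}}}\,\log q,\qquad \lambda_0(\overline\gamma\vee2\widetilde\eta)\le C\sqrt{\frac n{T_{\min}}}\,\log q .$$ -/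

import Mathlib

open MeasureTheory ProbabilityTheory

noncomputable section

namespace GSRL

/-- The Euclidean norm `‖v‖₂` of a finite real vector. -/
def l2 {ι : Type*} [Fintype ι] (v : ι → ℝ) : ℝ := ‖WithLp.toLp 2 v‖

/-- The supremum norm `‖v‖_∞`, the largest absolute value of a coordinate. -/
def linf {ι : Type*} [Fintype ι] (v : ι → ℝ) : ℝ := ‖v‖

/-- For a vector `v` whose coordinates carry group labels, the subvector `v^j` of the coordinates
in group `j`. -/
def block {ι : Type*} {q : ℕ} (label : ι → Fin q) (v : ι → ℝ) (j : Fin q) :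
    {i : ι // label i = j} → ℝ := fun i => v i

/-- A nonrandom `n × p` design matrix with normalized columns, together with a partition of the
`p` columns into `q` nonempty groups: column `k` lies in group `label k`. -/
structure Design (n p q : ℕ) where
  X : Matrix (Fin n) (Fin p) ℝ
  label : Fin p → Fin q
  label_surjective : Function.Surjective label
  /-- the diagonal of the Gram matrix `X'X / n` is equal to one -/
  normalized : ∀ k, (∑ i, X i k ^ 2) / (n : ℝ) = 1

namespace Design

variable {n p q : ℕ} (d : Design n p q)

/-- The size `T_j` of group `j`. -/
def T (j : Fin q) : ℕ := Fintype.card {k : Fin p // d.label k = j}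

/-- `T_min = min_j T_j`. -/
def Tmin : ℕ := ⨅ j, d.T j

/-- `T_max = max_j T_j`. -/
def Tmax : ℕ := ⨆ j, d.T j

/-- `X^j`, the columns of the design matrix in group `j`. -/
def Xgrp (j : Fin q) : Matrix (Fin n) {k : Fin p // d.label k = j} ℝ :=
  d.X.submatrix id Subtype.val

/-- `ζ = max_j ‖X^j‖² / n`, with the Euclidean operator norm. -/
def zeta : ℝ :=
  ⨆ j, ‖LinearMap.toContinuousLinearMap (Matrix.toEuclideanLin (d.Xgrp j))‖ ^ 2 / (n : ℝ)

/-- The active set `S = {j : β^j ≠ 0}` of a coefficient vector. -/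
def active (β : Fin p → ℝ) : Finset (Fin q) :=
  open Classical in Finset.univ.filter fun j => block d.label β j ≠ 0

/-- `s^* = ∑_{j ∈ S} T_j`. -/
def sstar (S : Finset (Fin q)) : ℕ := ∑ j ∈ S, d.T j

/-- The weighted group norm restricted to `J`: `∑_{j ∈ J} √T_j ‖β^j‖₂`. -/
def groupNorm (J : Finset (Fin q)) (β : Fin p → ℝ) : ℝ :=
  ∑ j ∈ J, √(d.T j : ℝ) * l2 (block d.label β j)

/-- The Group Square-Root Lasso criterion
`‖Y - Xβ‖₂ / √n + (λ / n) ∑_j √T_j ‖β^j‖₂`. -/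
def criterion (lam : ℝ) (Y : Fin n → ℝ) (β : Fin p → ℝ) : ℝ :=
  l2 (Y - d.X.mulVec β) / √(n : ℝ) + lam / n * d.groupNorm Finset.univ β

/-- `b` is a Group Square-Root Lasso estimator, that is, a global minimizer of the criterion. -/
def IsEstimator (lam : ℝ) (Y : Fin n → ℝ) (b : Fin p → ℝ) : Prop :=
  ∀ β, d.criterion lam Y b ≤ d.criterion lam Y β

/-- The Compatibility Condition `(κ, γ) ∈ C(X, S)`. -/
def Compat (S : Finset (Fin q)) (κ γ : ℝ) : Prop :=
  0 < κ ∧ 1 < γ ∧ ∀ δ : Fin p → ℝ, d.groupNorm Sᶜ δ ≤ γ * d.groupNorm S δ →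
    d.groupNorm S δ ≤ √(d.sstar S : ℝ) * l2 (d.X.mulVec δ) / (√(n : ℝ) * κ)

/-- Indices of the coordinates in the groups of `S`. -/
abbrev InS (S : Finset (Fin q)) : Type := {k : Fin p // d.label k ∈ S}

/-- Group labels of the coordinates in the groups of `S`. -/
def labelS (S : Finset (Fin q)) : d.InS S → Fin q := fun k => d.label k

/-- The Gram matrix `Σ = X'X / n`. -/
def gram : Matrix (Fin p) (Fin p) ℝ := (n : ℝ)⁻¹ • (d.X.transpose * d.X)

/-- The block `Σ_{1,1} = X_S' X_S / n` of the Gram matrix. -/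
def gram11 (S : Finset (Fin q)) : Matrix (d.InS S) (d.InS S) ℝ :=
  d.gram.submatrix Subtype.val Subtype.val

/-- The block `Σ_{2,1} = X_{S^c}' X_S / n`, completed to `p` rows by zero rows at the
coordinates in `S`. -/
def gram21 (S : Finset (Fin q)) : Matrix (Fin p) (d.InS S) ℝ :=
  fun k l => if d.label k ∈ S then 0 else d.gram k l

/-- The inverse `Σ_{1,1}⁻¹`, completed to `p` rows by zero rows at the coordinates outside `S`. -/
def gram11inv (S : Finset (Fin q)) : Matrix (Fin p) (d.InS S) ℝ :=
  fun k l => if h : d.label k ∈ S then (d.gram11 S)⁻¹ ⟨k, h⟩ l else 0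

/-- The vectors `v` over the coordinates in `S` such that `‖v^k‖₂ ≤ √T_k` for every group. -/
def groupBall (S : Finset (Fin q)) : Set (d.InS S → ℝ) :=
  {v | ∀ k, l2 (block (d.labelS S) v k) ≤ √(d.T k : ℝ)}

/-- The Group Irrepresentable Condition `η ∈ I(X, S)`. The maximum over the compact set
`groupBall S` is smaller than `η` exactly when every value is. -/
def Irrep (S : Finset (Fin q)) (η : ℝ) : Prop :=
  0 < η ∧ η < 1 ∧ IsUnit (d.gram11 S) ∧ ∀ v ∈ d.groupBall S, ∀ j,
    l2 (block d.label ((d.gram21 S * (d.gram11 S)⁻¹).mulVec v) j) / √(d.T j : ℝ) < η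

/-- `ξ = max_v max_j ‖(Σ_{1,1}⁻¹ v)^j‖_∞ / √T_j` over all `v` with `‖v^k‖₂ ≤ √T_k`. -/
def xi (S : Finset (Fin q)) : ℝ :=
  sSup {r | ∃ v ∈ d.groupBall S, ∃ j,
    r = linf (block d.label ((d.gram11inv S).mulVec v) j) / √(d.T j : ℝ)}

/-- The Beta Min Condition `m ∈ B(β)`; only the entries `m j` with `j` active matter. -/
def BetaMin (β : Fin p → ℝ) (m : Fin q → ℝ) : Prop :=
  ∀ j ∈ d.active β, m j ≤ linf (block d.label β j)

/-- The noise component `V = max_j √n ‖(X'ε)^j‖₂ / (√T_j ‖ε‖₂)`. -/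
def V (e : Fin n → ℝ) : ℝ :=
  ⨆ j, √(n : ℝ) * l2 (block d.label (d.X.transpose.mulVec e) j) / (√(d.T j : ℝ) * l2 e)

/-- The response vector `Y = Xβ + σε`. -/
def response (β : Fin p → ℝ) (σ : ℝ) (e : Fin n → ℝ) : Fin n → ℝ := d.X.mulVec β + σ • e

/-- The lower bound for the tuning parameter, with multiplier `c`:
`√(2ζ) n c / √(n - T_max) * (1 + √(2 log(2q/α) / T_min))`. -/
def tuning (c α : ℝ) : ℝ :=
  √(2 * d.zeta) * n * c / √((n : ℝ) - d.Tmax) *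
    (1 + √(2 * Real.log (2 * q / α) / d.Tmin))

/-- `u = 2γ / (1 - λ² s^* / (n² κ²))`. -/
def u (S : Finset (Fin q)) (κ γ lam : ℝ) : ℝ :=
  2 * γ / (1 - lam ^ 2 * d.sstar S / ((n : ℝ) ^ 2 * κ ^ 2))

end Design

/-- `γ̄ = (γ + 1) / (γ - 1)`. -/
def gammaBar (γ : ℝ) : ℝ := (γ + 1) / (γ - 1)

/-- `η̃ = (1 + η) / (1 - η)`. -/
def etaTilde (η : ℝ) : ℝ := (1 + η) / (1 - η)

/-- `t = √(4 log(1/α) / n) + 4 log(1/α) / n`. -/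
def tdev (n : ℕ) (α : ℝ) : ℝ :=
  √(4 * Real.log (1 / α) / n) + 4 * Real.log (1 / α) / n

namespace Design

variable {n p q : ℕ} (d : Design n p q)

/-- The prediction and estimation bounds for an estimate `b` of `β` with `S` the active set:
`‖X(b - β)‖₂ ≤ √(1+t) u σ λ √s^* / (κ √n)` and
`∑_j √T_j ‖(b - β)^j‖₂ ≤ (γ + 1) √(1+t) u σ λ s^* / (κ² n)`. -/
def PredictionBounds (α κ γ σ lam : ℝ) (β b : Fin p → ℝ) : Prop :=
  l2 (d.X.mulVec (b - β)) ≤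
      √(1 + tdev n α) * d.u (d.active β) κ γ lam *
        (σ * lam * √(d.sstar (d.active β) : ℝ) / (κ * √(n : ℝ))) ∧
    d.groupNorm Finset.univ (b - β) ≤
      (γ + 1) * √(1 + tdev n α) * d.u (d.active β) κ γ lam *
        (σ * lam * d.sstar (d.active β) / (κ ^ 2 * n))

/-- The constant `D = 2 √(1+t) (1 + u) ξ / (1 + η)` of the subset recovery bounds. -/
def recoveryConst (S : Finset (Fin q)) (α κ γ η lam : ℝ) : ℝ :=
  2 * √(1 + tdev n α) * (1 + d.u S κ γ lam) * d.xi S / (1 + η)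

/-- The subset recovery properties for an estimate `b` of `β` with `S` the active set:
`b_{S^c} = 0`; `‖(b - β)^j‖_∞ ≤ D √T_j σ λ / n` for every group; and `b` has active set `S`
whenever `β` satisfies a Beta Min Condition with `m_j ≥ D √T_j σ λ / n`. -/
def SubsetRecovery (α κ γ η σ lam : ℝ) (β b : Fin p → ℝ) : Prop :=
  (∀ j ∉ d.active β, block d.label b j = 0) ∧
    (∀ j, linf (block d.label (b - β) j) ≤
      d.recoveryConst (d.active β) α κ γ η lam * (√(d.T j : ℝ) * σ * lam / n)) ∧
    ((∃ m, d.BetaMin β m ∧ ∀ j ∈ d.active β,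
      d.recoveryConst (d.active β) α κ γ η lam * (√(d.T j : ℝ) * σ * lam / n) ≤ m j) →
      d.active b = d.active β)

end Design

/-- The property `Q` holds with probability at least `r`, namely on a measurable event of such
probability. -/
def WithProb {Ω : Type*} [MeasurableSpace Ω] (P : Measure Ω) (r : ℝ) (Q : Ω → Prop) : Prop :=
  ∃ E, MeasurableSet E ∧ r ≤ P.real E ∧ ∀ ω ∈ E, Q ω

end GSRL

end

/-! The proof splits into one probabilistic estimate, a deterministic analysis of the minimizer for
a fixed noise vector, and a comparison of orders of magnitude.

Probability. An exponential moment of `‖A'x‖²` for Gaussian `x` is computed by writing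
`exp(s‖A'x‖²)` as an average of exponentials of linear forms over an independent Gaussian vector
`g`. Integrating out `x` first leaves `exp(s‖Ag‖²) ≤ exp(sK‖g‖²)`, so only the squared operator norm
bound `K` and the number of columns matter (`stdGaussian_le_l2_sq_mulVec`). Applied to each group,
and combined with a lower tail bound for `‖ε‖²` and a union bound, this controls `V`
(`stdGaussian_tuning_lt_V`); applied to the identity matrix, it controls `‖ε‖²` from above
(`stdGaussian_noise_level`). Intersecting the two events costs `2α`.

Prediction and estimation. Put `B = λ/c`, where `V ≤ B`. Convexity of the residual norm and
minimality place the error in the cone of the compatibility condition (`IsEstimator.cone`). The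
basic inequality, squared, is then a quadratic inequality in `‖X(b - β)‖`, whose leading coefficient
is positive because of the bound on `s*` (`IsEstimator.l2_mulVec_le`).

Subset recovery is a primal-dual witness argument. A minimizer among vectors supported on `S`
satisfies first-order conditions (`IsRestrictedMin.subgradient`); the irrepresentable condition
makes them strict outside `S` (`l2_score_lt`), and strictness forces every global minimizer to
vanish outside `S` (`IsEstimator.mem_supportedOn`). The error of such a minimizer is a scaled image
of the group ball under `Σ₁₁⁻¹` (`exists_groupBall_error`), which gives the sup-norm bound, and with
a strict inequality between scales also exact support recovery. -/

noncomputable section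

namespace GSRL

/-! ### Euclidean norm of finite vectors -/

section Norms

variable {ι : Type*} [Fintype ι]

theorem l2_nonneg (v : ι → ℝ) : 0 ≤ l2 v := norm_nonneg _

theorem l2_sq (v : ι → ℝ) : l2 v ^ 2 = ∑ i, v i ^ 2 := by
  simp [l2, EuclideanSpace.norm_sq_eq]

theorem l2_sq_eq_dotProduct (v : ι → ℝ) : l2 v ^ 2 = v ⬝ᵥ v := by
  rw [l2_sq]
  simp [dotProduct, sq]

theorem l2_add_le (v w : ι → ℝ) : l2 (v + w) ≤ l2 v + l2 w := by
  simpa [l2] using norm_add_le (WithLp.toLp 2 v) (WithLp.toLp 2 w)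

theorem l2_sub_le (v w : ι → ℝ) : l2 (v - w) ≤ l2 v + l2 w := by
  simpa [l2] using norm_sub_le (WithLp.toLp 2 v) (WithLp.toLp 2 w)

theorem l2_smul (c : ℝ) (v : ι → ℝ) : l2 (c • v) = |c| * l2 v := by
  simp [l2, norm_smul]

@[simp] theorem l2_zero : l2 (0 : ι → ℝ) = 0 := by
  simp [l2]

theorem l2_eq_zero {v : ι → ℝ} : l2 v = 0 ↔ v = 0 := by
  simp [l2]

theorem dotProduct_le_l2_mul_l2 (v w : ι → ℝ) : v ⬝ᵥ w ≤ l2 v * l2 w := by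
  have h := real_inner_le_norm (WithLp.toLp 2 w) (WithLp.toLp 2 v)
  rw [EuclideanSpace.inner_eq_star_dotProduct] at h
  simpa [l2, mul_comm] using h

theorem continuous_l2 : Continuous (l2 : (ι → ℝ) → ℝ) := by
  unfold l2
  fun_prop

theorem measurable_l2 : Measurable (l2 : (ι → ℝ) → ℝ) := continuous_l2.measurable

end Norms

/-! ### Chernoff bounds for Gaussian quadratic forms -/

section Gaussian

/-- The standard Gaussian measure on `ℝ^ι`. -/
def stdGaussian (ι : Type*) [Fintype ι] : Measure (ι → ℝ) :=
  Measure.pi fun _ => gaussianReal 0 1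

instance (ι : Type*) [Fintype ι] : IsProbabilityMeasure (stdGaussian ι) := by
  unfold stdGaussian
  infer_instance

theorem integral_exp_mul_sq_gaussianReal {s : ℝ} (hs : 2 * s < 1) :
    ∫ x, Real.exp (s * x ^ 2) ∂(gaussianReal 0 1) = (√(1 - 2 * s))⁻¹ := by
  rw [integral_gaussianReal_eq_integral_smul one_ne_zero]
  have h : ∀ x : ℝ, gaussianPDFReal 0 1 x • Real.exp (s * x ^ 2)
      = (√(2 * Real.pi))⁻¹ * Real.exp (-(1 / 2 - s) * x ^ 2) := by
    intro x
    simp only [gaussianPDFReal, smul_eq_mul, NNReal.coe_one, mul_one, sub_zero]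
    rw [mul_assoc, ← Real.exp_add]
    ring_nf
  simp_rw [h]
  rw [integral_const_mul, integral_gaussian, ← Real.sqrt_inv, ← Real.sqrt_inv,
    ← Real.sqrt_mul (by positivity)]
  congr 1
  have : 1 - 2 * s ≠ 0 := by linarith
  have : 1 / 2 - s ≠ 0 := by intro h; apply this; linarith
  field_simp

/-- The Bochner integral of a non-integrable function is `0`, whereas the computed value is
positive. -/
theorem integrable_exp_mul_sq_gaussianReal {s : ℝ} (hs : 2 * s < 1) :
    Integrable (fun x => Real.exp (s * x ^ 2)) (gaussianReal 0 1) := by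
  by_contra h
  have h0 := integral_undef h
  rw [integral_exp_mul_sq_gaussianReal hs] at h0
  have : 0 < √(1 - 2 * s) := Real.sqrt_pos.2 (by linarith)
  exact (inv_pos.2 this).ne' h0

variable {ι κ : Type*} [Fintype ι] [Fintype κ]

/-- Exponential moments are kept as lower Lebesgue integrals, so that the later exchange of
integrals needs only measurability. -/
theorem lintegral_ofReal_prod_stdGaussian (f : ι → ℝ → ℝ) (h0 : ∀ i x, 0 ≤ f i x)
    (hf : ∀ i, Integrable (f i) (gaussianReal 0 1)) :
    ∫⁻ x, ENNReal.ofReal (∏ i, f i (x i)) ∂(stdGaussian ι)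
      = ENNReal.ofReal (∏ i, ∫ x, f i x ∂(gaussianReal 0 1)) := by
  unfold stdGaussian
  rw [← integral_fintype_prod_eq_prod (μ := fun _ : ι => gaussianReal 0 1) f,
    ofReal_integral_eq_lintegral_ofReal]
  · exact Integrable.fintype_prod (μ := fun _ : ι => gaussianReal 0 1) hf
  · exact Filter.Eventually.of_forall fun x => Finset.prod_nonneg fun i _ => h0 i _

theorem lintegral_exp_dotProduct_stdGaussian (a : ι → ℝ) :
    ∫⁻ x, ENNReal.ofReal (Real.exp (a ⬝ᵥ x)) ∂(stdGaussian ι)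
      = ENNReal.ofReal (Real.exp (l2 a ^ 2 / 2)) := by
  have h := lintegral_ofReal_prod_stdGaussian (fun i x => Real.exp (a i * x))
    (fun i x => (Real.exp_pos _).le) (fun i => integrable_exp_mul_gaussianReal (a i))
  have hm : ∀ t : ℝ, ∫ x, Real.exp (t * x) ∂(gaussianReal 0 1) = Real.exp (t ^ 2 / 2) := by
    intro t
    have := congrFun (mgf_fun_id_gaussianReal (μ := 0) (v := 1)) t
    simpa [mgf] using this
  simp_rw [hm, ← Real.exp_sum] at h
  simp only [dotProduct]
  rw [h, l2_sq, Finset.sum_div]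

theorem lintegral_exp_mul_l2_sq_stdGaussian {s : ℝ} (hs : 2 * s < 1) :
    ∫⁻ x, ENNReal.ofReal (Real.exp (s * l2 x ^ 2)) ∂(stdGaussian ι)
      = ENNReal.ofReal ((√(1 - 2 * s))⁻¹ ^ Fintype.card ι) := by
  have h := lintegral_ofReal_prod_stdGaussian (ι := ι) (fun _ x => Real.exp (s * x ^ 2))
    (fun i x => (Real.exp_pos _).le) (fun i => integrable_exp_mul_sq_gaussianReal hs)
  simp_rw [integral_exp_mul_sq_gaussianReal hs, ← Real.exp_sum, ← Finset.mul_sum, ← l2_sq] at h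
  simpa using h

/-- The exponential moment of a Gaussian quadratic form, by linearising the square with an
independent Gaussian vector. -/
theorem lintegral_exp_mul_l2_sq_mulVec_le (A : Matrix ι κ ℝ) {K s : ℝ}
    (hA : ∀ g, l2 (A.mulVec g) ^ 2 ≤ K * l2 g ^ 2) (hs : 0 ≤ s) (hsK : 2 * (s * K) < 1) :
    ∫⁻ x, ENNReal.ofReal (Real.exp (s * l2 (A.transpose.mulVec x) ^ 2)) ∂(stdGaussian ι)
      ≤ ENNReal.ofReal ((√(1 - 2 * (s * K)))⁻¹ ^ Fintype.card κ) := by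
  have hr : √(2 * s) ^ 2 = 2 * s := Real.sq_sqrt (by positivity)
  -- The factor `√(2s)` is chosen so that the Gaussian moment `exp(‖a‖²/2)` at `a = √(2s) A'x`
  -- equals `exp(s‖A'x‖²)`.
  have h1 : ∀ x, ENNReal.ofReal (Real.exp (s * l2 (A.transpose.mulVec x) ^ 2))
      = ∫⁻ g, ENNReal.ofReal (Real.exp ((√(2 * s) • A.transpose.mulVec x) ⬝ᵥ g))
        ∂(stdGaussian κ) := by
    intro x
    rw [lintegral_exp_dotProduct_stdGaussian, l2_smul, mul_pow, sq_abs, hr]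
    ring_nf
  have h2 : ∀ (x : ι → ℝ) (g : κ → ℝ), (√(2 * s) • A.transpose.mulVec x) ⬝ᵥ g
      = (√(2 * s) • A.mulVec g) ⬝ᵥ x := by
    intro x g
    rw [smul_dotProduct, smul_dotProduct, Matrix.mulVec_transpose, ← Matrix.dotProduct_mulVec,
      dotProduct_comm]
  simp_rw [h1, h2]
  rw [lintegral_lintegral_swap]
  · simp_rw [lintegral_exp_dotProduct_stdGaussian]
    rw [← lintegral_exp_mul_l2_sq_stdGaussian hsK]
    refine lintegral_mono fun g => ENNReal.ofReal_le_ofReal (Real.exp_le_exp.2 ?_)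
    rw [l2_smul, mul_pow, sq_abs, hr]
    nlinarith [hA g]
  · refine Measurable.aemeasurable ?_
    refine ENNReal.measurable_ofReal.comp (Real.measurable_exp.comp ?_)
    refine Continuous.measurable ?_
    simp only [dotProduct]
    fun_prop

/-- Chernoff bound on the upper tail of a Gaussian quadratic form. -/
theorem stdGaussian_le_l2_sq_mulVec [Nonempty κ] (A : Matrix ι κ ℝ) {K r : ℝ} (hK : 0 < K)
    (hA : ∀ g, l2 (A.mulVec g) ^ 2 ≤ K * l2 g ^ 2) (hr : 1 ≤ r) :
    (stdGaussian ι).real {x | K * (Fintype.card κ * r) ≤ l2 (A.transpose.mulVec x) ^ 2}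
      ≤ Real.exp (-(Fintype.card κ / 2 * (r - 1 - Real.log r))) := by
  have hr0 : 0 < r := by linarith
  set m : ℝ := (Fintype.card κ : ℝ) with hm
  have hinv : r⁻¹ ≤ 1 := inv_le_one_of_one_le₀ hr
  -- The minimizer of the Chernoff bound `(1 - 2sK)^(-m/2) exp(-sKmr)`, characterized by `1 - 2sK =
  -- 1/r`.
  set s : ℝ := (1 - r⁻¹) / (2 * K) with hs
  have hs0 : 0 ≤ s := div_nonneg (by linarith) (by positivity)
  have hsK : s * K = (1 - r⁻¹) / 2 := by rw [hs]; field_simp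
  have hlt : 2 * (s * K) < 1 := by
    rw [hsK]
    have := inv_pos.2 hr0
    linarith
  have hI := lintegral_exp_mul_l2_sq_mulVec_le A hA hs0 hlt
  have hmeas : Measurable fun x : ι → ℝ =>
      ENNReal.ofReal (Real.exp (s * l2 (A.transpose.mulVec x) ^ 2)) := by
    refine ENNReal.measurable_ofReal.comp (Real.measurable_exp.comp ?_)
    refine measurable_const.mul ((measurable_l2.comp ?_).pow_const 2)
    refine Continuous.measurable ?_
    fun_prop
  have hM := meas_ge_le_lintegral_div hmeas.aemeasurable (μ := stdGaussian ι)
    (ε := ENNReal.ofReal (Real.exp (s * (K * (m * r)))))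
    (by simp [Real.exp_pos]) ENNReal.ofReal_ne_top
  have hsub : {x : ι → ℝ | K * (m * r) ≤ l2 (A.transpose.mulVec x) ^ 2} ⊆
      {x | ENNReal.ofReal (Real.exp (s * (K * (m * r))))
        ≤ ENNReal.ofReal (Real.exp (s * l2 (A.transpose.mulVec x) ^ 2))} := fun x hx =>
    ENNReal.ofReal_le_ofReal (Real.exp_le_exp.2 (mul_le_mul_of_nonneg_left hx hs0))
  have hval : (√(1 - 2 * (s * K)))⁻¹ ^ Fintype.card κ / Real.exp (s * (K * (m * r)))
      = Real.exp (-(m / 2 * (r - 1 - Real.log r))) := by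
    have e1 : 1 - 2 * (s * K) = r⁻¹ := by rw [hsK]; ring
    have e2 : (√(r⁻¹))⁻¹ = Real.exp (Real.log r / 2) := by
      rw [← Real.sqrt_inv, inv_inv, ← Real.log_sqrt hr0.le, Real.exp_log (Real.sqrt_pos.2 hr0)]
    have e3 : s * (K * (m * r)) = m / 2 * (r - 1) := by
      calc s * (K * (m * r)) = (s * K) * m * r := by ring
        _ = _ := by rw [hsK]; field_simp
    rw [e1, e2, e3, ← Real.exp_nat_mul, ← Real.exp_sub]
    congr 1
    rw [← hm]
    ring
  have := (measure_mono hsub).trans (hM.trans (ENNReal.div_le_div_right hI _))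
  rw [← ENNReal.ofReal_div_of_pos (Real.exp_pos _), hval] at this
  exact ENNReal.toReal_le_of_le_ofReal (Real.exp_pos _).le this

/-- A Gaussian vector in dimension `m` has squared norm at most `m / 2` with exponentially small
probability. -/
theorem stdGaussian_l2_sq_le_half :
    (stdGaussian ι).real {x | l2 x ^ 2 ≤ Fintype.card ι / 2}
      ≤ Real.exp (-(Fintype.card ι / 16 : ℝ)) := by
  set m : ℝ := (Fintype.card ι : ℝ) with hm
  -- The exponent `-1/2` is optimal at level `m/2`. It yields `exp(-m (log 2 / 2 - 1/4))`, and `log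
  -- 2 / 2 - 1/4` exceeds `1/16`.
  have hI := lintegral_exp_mul_l2_sq_stdGaussian (ι := ι) (s := -(1 / 2)) (by norm_num)
  have hmeas : Measurable fun x : ι → ℝ => ENNReal.ofReal (Real.exp (-(1 / 2) * l2 x ^ 2)) :=
    ENNReal.measurable_ofReal.comp (Real.measurable_exp.comp
      (measurable_const.mul (measurable_l2.pow_const 2)))
  have hM := meas_ge_le_lintegral_div hmeas.aemeasurable (μ := stdGaussian ι)
    (ε := ENNReal.ofReal (Real.exp (-(1 / 2) * (m / 2))))
    (by simp [Real.exp_pos]) ENNReal.ofReal_ne_top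
  have hsub : {x : ι → ℝ | l2 x ^ 2 ≤ m / 2} ⊆
      {x | ENNReal.ofReal (Real.exp (-(1 / 2) * (m / 2)))
        ≤ ENNReal.ofReal (Real.exp (-(1 / 2) * l2 x ^ 2))} := fun x hx =>
    ENNReal.ofReal_le_ofReal (Real.exp_le_exp.2 (by
      have : l2 x ^ 2 ≤ m / 2 := hx
      linarith))
  have hval : (√(1 - 2 * (-(1 / 2))))⁻¹ ^ Fintype.card ι / Real.exp (-(1 / 2) * (m / 2))
      ≤ Real.exp (-(m / 16)) := by
    have e2 : (√(1 - 2 * (-(1 / 2))))⁻¹ = Real.exp (-(Real.log 2 / 2)) := by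
      rw [Real.exp_neg, ← Real.log_sqrt (by norm_num), Real.exp_log (by positivity)]
      norm_num
    rw [e2, ← Real.exp_nat_mul, ← Real.exp_sub, Real.exp_le_exp, ← hm]
    have : 0 ≤ m := by positivity
    nlinarith [Real.log_two_gt_d9]
  have := (measure_mono hsub).trans hM
  rw [hI, ← ENNReal.ofReal_div_of_pos (Real.exp_pos _)] at this
  exact ENNReal.toReal_le_of_le_ofReal (Real.exp_pos _).le
    (this.trans (ENNReal.ofReal_le_ofReal hval))

theorem stdGaussian_real_preimage {Ω : Type*} [MeasurableSpace Ω] {P : Measure Ω}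
    [IsProbabilityMeasure P] {ε : ι → Ω → ℝ} (hm : ∀ i, Measurable (ε i))
    (hg : ∀ i, P.map (ε i) = gaussianReal 0 1) (hi : iIndepFun ε P) {s : Set (ι → ℝ)}
    (hs : MeasurableSet s) : P.real {ω | (fun i => ε i ω) ∈ s} = (stdGaussian ι).real s := by
  have h := (iIndepFun_iff_map_fun_eq_pi_map fun i => (hm i).aemeasurable).1 hi
  simp_rw [hg] at h
  rw [stdGaussian, ← h, map_measureReal_apply (measurable_pi_lambda _ hm) hs]
  rfl

end Gaussian

/-! ### The deviation term `t` and the noise level -/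

theorem tdev_nonneg {n : ℕ} {α : ℝ} (hα0 : 0 < α) (hα1 : α < 1) : 0 ≤ tdev n α := by
  have : 0 ≤ Real.log (1 / α) := Real.log_nonneg (by rw [le_div_iff₀ hα0]; linarith)
  unfold tdev
  positivity

theorem tdev_le {n : ℕ} {α : ℝ} (hn : 0 < n) (h : 16 * Real.log (1 / α) ≤ n) :
    tdev n α ≤ 3 / 4 := by
  have hn' : (0 : ℝ) < n := by exact_mod_cast hn
  have h1 : 4 * Real.log (1 / α) / n ≤ 1 / 4 := by
    rw [div_le_iff₀ hn']
    linarith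
  have h2 : √(4 * Real.log (1 / α) / n) ≤ 1 / 2 := by
    rw [Real.sqrt_le_left (by norm_num)]
    linarith
  unfold tdev
  linarith

/-- With `r = 1 + w + w²` this bounds the Chernoff rate `r - 1 - log r` below by `w²/2`. It follows
from `1 + x + x²/2 ≤ exp x` at `x = w + w²/2`. -/
theorem log_one_add_add_sq_le {w : ℝ} (hw : 0 ≤ w) :
    Real.log (1 + (w + w ^ 2)) ≤ w + w ^ 2 / 2 := by
  rw [Real.log_le_iff_le_exp (by positivity)]
  have := Real.quadratic_le_exp_of_nonneg (x := w + w ^ 2 / 2) (by positivity)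
  nlinarith [pow_nonneg hw 3, pow_nonneg hw 4]

/-- The squared norm of a standard Gaussian vector is at most `n (1 + t)` up to probability `α`. -/
theorem stdGaussian_noise_level {n : ℕ} {α : ℝ} (hn : 0 < n) (hα0 : 0 < α) (hα1 : α < 1) :
    (stdGaussian (Fin n)).real {x | (n : ℝ) * (1 + tdev n α) ≤ l2 x ^ 2} ≤ α := by
  have : Nonempty (Fin n) := ⟨⟨0, hn⟩⟩
  have hn' : (0 : ℝ) < n := by exact_mod_cast hn
  have hL : 0 ≤ Real.log (1 / α) := Real.log_nonneg (by rw [le_div_iff₀ hα0]; linarith)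
  have ht := tdev_nonneg (n := n) hα0 hα1
  have h := stdGaussian_le_l2_sq_mulVec (1 : Matrix (Fin n) (Fin n) ℝ) (K := 1) one_pos
    (fun g => by simp) (r := 1 + tdev n α) (by linarith)
  simp only [Fintype.card_fin, one_mul, Matrix.transpose_one, Matrix.one_mulVec] at h
  refine h.trans ?_
  -- Here `t = w + w²`, so the Chernoff exponent is at least `n w² / 4 = log(1/α)`.
  set w := √(4 * Real.log (1 / α) / n) with hw
  have hw2 : w ^ 2 = 4 * Real.log (1 / α) / n := Real.sq_sqrt (by positivity)
  have htw : tdev n α = w + w ^ 2 := by rw [hw2]; rfl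
  have hlog := log_one_add_add_sq_le (Real.sqrt_nonneg (4 * Real.log (1 / α) / n))
  rw [← hw] at hlog
  have hwn : (n : ℝ) * w ^ 2 = 4 * Real.log (1 / α) := by rw [hw2]; field_simp
  calc Real.exp (-(n / 2 * (1 + tdev n α - 1 - Real.log (1 + tdev n α))))
      ≤ Real.exp (-Real.log (1 / α)) := by
        rw [Real.exp_le_exp, htw]
        nlinarith
    _ = α := by rw [one_div, Real.log_inv, neg_neg, Real.exp_log hα0]

theorem gammaBar_gt_one {γ : ℝ} (hγ : 1 < γ) : 1 < gammaBar γ := by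
  unfold gammaBar
  rw [lt_div_iff₀ (by linarith)]
  linarith

/-! ### Tuning parameter and the event that bounds `V` -/

namespace Design

variable {n p q : ℕ} (d : Design n p q)

theorem T_pos (j : Fin q) : 0 < d.T j := by
  obtain ⟨k, hk⟩ := d.label_surjective j
  exact Fintype.card_pos_iff.2 ⟨⟨k, hk⟩⟩

theorem Tmin_le_T (j : Fin q) : d.Tmin ≤ d.T j :=
  ciInf_le (OrderBot.bddBelow _) j

theorem Tmin_pos (hq : 0 < q) : 0 < d.Tmin := by
  have : Nonempty (Fin q) := ⟨⟨0, hq⟩⟩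
  obtain ⟨j, hj⟩ := exists_eq_ciInf_of_finite (f := d.T)
  exact (d.T_pos j).trans_le hj.le

theorem Tmax_lt (hq : 0 < q) (hT : ∀ j, d.T j < n) : d.Tmax < n := by
  have : Nonempty (Fin q) := ⟨⟨0, hq⟩⟩
  obtain ⟨j, hj⟩ := exists_eq_ciSup_of_finite (f := d.T)
  exact hj.symm.le.trans_lt (hT j)

theorem l2_Xgrp_mulVec_sq_le (hn : 0 < n) (j : Fin q) (g : {k : Fin p // d.label k = j} → ℝ) :
    l2 ((d.Xgrp j).mulVec g) ^ 2 ≤ n * d.zeta * l2 g ^ 2 := by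
  have hn' : (0 : ℝ) < n := by exact_mod_cast hn
  set A := LinearMap.toContinuousLinearMap (Matrix.toEuclideanLin (d.Xgrp j)) with hA
  have h1 : l2 ((d.Xgrp j).mulVec g) ≤ ‖A‖ * l2 g := by
    have := A.le_opNorm (WithLp.toLp 2 g)
    simpa [hA, l2, Matrix.toLpLin_apply] using this
  have h2 : ‖A‖ ^ 2 / n ≤ d.zeta := by
    unfold zeta
    exact le_ciSup (f := fun j => ‖LinearMap.toContinuousLinearMap
      (Matrix.toEuclideanLin (d.Xgrp j))‖ ^ 2 / (n : ℝ)) (Set.finite_range _).bddAbove j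
  rw [div_le_iff₀ hn'] at h2
  calc l2 ((d.Xgrp j).mulVec g) ^ 2 ≤ (‖A‖ * l2 g) ^ 2 := pow_le_pow_left₀ (l2_nonneg _) h1 2
    _ = ‖A‖ ^ 2 * l2 g ^ 2 := by ring
    _ ≤ n * d.zeta * l2 g ^ 2 := by
      rw [mul_comm (n : ℝ)]
      exact mul_le_mul_of_nonneg_right h2 (sq_nonneg _)

/-- A single normalized column has squared norm `n`, so a coordinate vector already witnesses the
bound. This makes the tuning parameter strictly positive. -/
theorem one_le_zeta (hq : 0 < q) (hn : 0 < n) : 1 ≤ d.zeta := by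
  have hn' : (0 : ℝ) < n := by exact_mod_cast hn
  obtain ⟨k, hk⟩ := d.label_surjective ⟨0, hq⟩
  have h := d.l2_Xgrp_mulVec_sq_le hn (d.label k) (Pi.single ⟨k, rfl⟩ 1)
  have h1 := d.normalized k
  rw [div_eq_one_iff_eq hn'.ne'] at h1
  have h2 : l2 (Pi.single (⟨k, rfl⟩ : {i : Fin p // d.label i = d.label k}) (1 : ℝ)) ^ 2 = 1 := by
    rw [l2_sq_eq_dotProduct]
    simp
  rw [h2, l2_sq] at h
  simp only [Matrix.mulVec_single_one, Matrix.col_apply, Xgrp, Matrix.submatrix_apply, id, h1,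
    mul_one] at h
  nlinarith

theorem log_two_mul_div_pos {α : ℝ} (hq : 0 < q) (hα0 : 0 < α) (hα1 : α < 1) :
    0 < Real.log (2 * q / α) := by
  have hq' : (1 : ℝ) ≤ q := by exact_mod_cast hq
  apply Real.log_pos
  rw [lt_div_iff₀ hα0]
  linarith

theorem tuning_eq_mul (c α : ℝ) : d.tuning c α = c * d.tuning 1 α := by
  unfold tuning
  ring

theorem tuning_one_pos {α : ℝ} (hq : 0 < q) (hT : ∀ j, d.T j < n) : 0 < d.tuning 1 α := by
  have hn : 0 < n := Nat.zero_lt_of_lt (hT ⟨0, hq⟩)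
  have hn' : (0 : ℝ) < n := by exact_mod_cast hn
  have h1 : (0 : ℝ) < n - d.Tmax := sub_pos.2 (by exact_mod_cast d.Tmax_lt hq hT)
  have h2 := d.one_le_zeta hq hn
  unfold tuning
  positivity

theorem measurable_V : Measurable d.V := by
  unfold V
  refine Measurable.iSup fun j => ?_
  refine (measurable_const.mul (measurable_l2.comp ?_)).div (measurable_const.mul measurable_l2)
  refine Continuous.measurable ?_
  unfold block
  fun_prop

/-- The product form also covers `e = 0`, where the quotients in `V` are divisions by zero. -/
theorem l2_block_le_V (e : Fin n → ℝ) (j : Fin q) :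
    √(n : ℝ) * l2 (block d.label (d.X.transpose.mulVec e) j) ≤ d.V e * (√(d.T j : ℝ) * l2 e) := by
  rcases (l2_nonneg e).eq_or_lt with h | h
  · have : e = 0 := l2_eq_zero.1 h.symm
    subst this
    have : block d.label (d.X.transpose.mulVec 0) j = 0 := by
      ext k
      simp [block]
    rw [this]
    simp
  · have hT : 0 < √(d.T j : ℝ) := Real.sqrt_pos.2 (by exact_mod_cast d.T_pos j)
    rw [← div_le_iff₀ (by positivity)]
    exact le_ciSup (f := fun j => √(n : ℝ) * l2 (block d.label (d.X.transpose.mulVec e) j) /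
      (√(d.T j : ℝ) * l2 e)) (Set.finite_range _).bddAbove j

theorem V_le_of_l2_block_lt {α : ℝ} (hq : 0 < q) (hα0 : 0 < α) (hα1 : α < 1)
    (hT : ∀ j, d.T j < n) {e : Fin n → ℝ} (he : (n : ℝ) / 2 < l2 e ^ 2)
    (h : ∀ j, l2 (block d.label (d.X.transpose.mulVec e) j) ^ 2 <
      n * d.zeta * (d.T j * (1 + √(2 * Real.log (2 * q / α) / d.T j)) ^ 2)) :
    d.V e ≤ d.tuning 1 α := by
  have : Nonempty (Fin q) := ⟨⟨0, hq⟩⟩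
  have hn : 0 < n := Nat.zero_lt_of_lt (hT ⟨0, hq⟩)
  have hn' : (0 : ℝ) < n := by exact_mod_cast hn
  have hTm : (0 : ℝ) < n - d.Tmax := sub_pos.2 (by exact_mod_cast d.Tmax_lt hq hT)
  have hζ := d.one_le_zeta hq hn
  have hL := log_two_mul_div_pos hq hα0 hα1
  have hTmin : (0 : ℝ) < d.Tmin := by exact_mod_cast d.Tmin_pos hq
  refine ciSup_le fun j => ?_
  have hTj : (0 : ℝ) < d.T j := by exact_mod_cast d.T_pos j
  have hTj' : (d.Tmin : ℝ) ≤ d.T j := by exact_mod_cast d.Tmin_le_T j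
  set z := 1 + √(2 * Real.log (2 * q / α) / d.T j) with hz
  set z' := 1 + √(2 * Real.log (2 * q / α) / d.Tmin) with hz'
  have hz0 : 0 < z := by positivity
  have hzz : z ≤ z' := by
    rw [hz, hz']
    gcongr
  have hl : 0 < l2 e := by
    rcases (l2_nonneg e).eq_or_lt with h0 | h0
    · rw [← h0] at he
      nlinarith
    · exact h0
  have hB : 0 ≤ d.tuning 1 α := (d.tuning_one_pos hq hT).le
  rw [div_le_iff₀ (by positivity)]
  refine le_of_sq_le_sq ?_ (by positivity)
  have e1 : (√(n : ℝ) * l2 (block d.label (d.X.transpose.mulVec e) j)) ^ 2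
      ≤ n * (n * d.zeta * (d.T j * z ^ 2)) := by
    rw [mul_pow, Real.sq_sqrt hn'.le]
    exact mul_le_mul_of_nonneg_left (h j).le hn'.le
  have e2 : (d.tuning 1 α * (√(d.T j : ℝ) * l2 e)) ^ 2
      = 2 * d.zeta * n ^ 2 / (n - d.Tmax) * z' ^ 2 * (d.T j * l2 e ^ 2) := by
    unfold tuning
    rw [← hz', mul_pow, mul_pow, mul_pow, div_pow, mul_pow, mul_pow,
      Real.sq_sqrt (by positivity), Real.sq_sqrt hTm.le, Real.sq_sqrt hTj.le]
    ring
  -- The quantity `n - T_max` enters the tuning parameter only as a lower bound for `n`.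
  have e3 : (n - d.Tmax : ℝ) / 2 ≤ l2 e ^ 2 := by
    have : (0 : ℝ) ≤ d.Tmax := by positivity
    linarith
  rw [e2]
  refine e1.trans ?_
  calc (n : ℝ) * (n * d.zeta * (d.T j * z ^ 2))
      = 2 * d.zeta * n ^ 2 / (n - d.Tmax) * z ^ 2 * (d.T j * ((n - d.Tmax) / 2)) := by
        field_simp
    _ ≤ _ := by gcongr

/-- A union bound over the `q` group events and the event that `‖x‖²` is at most `n/2`. Each has
probability at most `α/(2q)`, and `(q + 1)/(2q) ≤ 1`. -/
theorem stdGaussian_tuning_lt_V {α : ℝ} (hq : 0 < q) (hα0 : 0 < α) (hα1 : α < 1)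
    (hT : ∀ j, d.T j < n) (hlog : 16 * Real.log (2 * q / α) ≤ (n : ℝ) - d.Tmax) :
    (stdGaussian (Fin n)).real {x | d.tuning 1 α < d.V x} ≤ α := by
  have hn : 0 < n := Nat.zero_lt_of_lt (hT ⟨0, hq⟩)
  have hn' : (0 : ℝ) < n := by exact_mod_cast hn
  have hq' : (1 : ℝ) ≤ q := by exact_mod_cast hq
  have hζ := d.one_le_zeta hq hn
  have hL := log_two_mul_div_pos hq hα0 hα1
  set L := Real.log (2 * q / α) with hLdef
  have hexp : Real.exp (-L) = α / (2 * q) := by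
    rw [hLdef, Real.exp_neg, Real.exp_log (by positivity), inv_div]
  set A : Fin q → Set (Fin n → ℝ) := fun j => {x | n * d.zeta *
    (Fintype.card {k : Fin p // d.label k = j} * (1 + √(2 * L / d.T j)) ^ 2)
      ≤ l2 ((d.Xgrp j).transpose.mulVec x) ^ 2} with hAdef
  set B : Set (Fin n → ℝ) := {x | l2 x ^ 2 ≤ Fintype.card (Fin n) / 2} with hBdef
  have hsub : {x | d.tuning 1 α < d.V x} ⊆ (⋃ j, A j) ∪ B := by
    intro x hx
    by_contra hc
    rw [Set.mem_union, Set.mem_iUnion, not_or, not_exists] at hc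
    refine (not_le.2 hx) (d.V_le_of_l2_block_lt hq hα0 hα1 hT ?_ fun j => ?_)
    · simpa [hBdef] using hc.2
    · exact not_le.1 fun hj => hc.1 j hj
  have hA : ∀ j, (stdGaussian (Fin n)).real (A j) ≤ α / (2 * q) := by
    intro j
    have hTj : (0 : ℝ) < d.T j := by exact_mod_cast d.T_pos j
    have : Nonempty {k : Fin p // d.label k = j} := Fintype.card_pos_iff.1 (d.T_pos j)
    set z := √(2 * L / d.T j) with hz
    have hz0 : 0 ≤ z := Real.sqrt_nonneg _
    have hz2 : d.T j * z ^ 2 = 2 * L := by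
      rw [hz, Real.sq_sqrt (by positivity)]
      field_simp
    -- With `r = (1 + z)²` and `log(1 + z) ≤ z`, the rate `r - 1 - log r` is at least `z²`, and `T_j
    -- z² / 2 = L`.
    refine (stdGaussian_le_l2_sq_mulVec (d.Xgrp j) (K := n * d.zeta) (by positivity)
      (d.l2_Xgrp_mulVec_sq_le hn j) (r := (1 + z) ^ 2) (by nlinarith)).trans ?_
    rw [← hexp, Real.exp_le_exp, Real.log_pow]
    have hlz : Real.log (1 + z) ≤ z := by
      have := Real.log_le_sub_one_of_pos (show 0 < 1 + z by linarith)
      linarith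
    change -((d.T j : ℝ) / 2 * _) ≤ _
    push_cast
    nlinarith
  have hB : (stdGaussian (Fin n)).real B ≤ α / (2 * q) := by
    refine stdGaussian_l2_sq_le_half.trans ?_
    rw [← hexp, Real.exp_le_exp, Fintype.card_fin]
    have : (0 : ℝ) ≤ d.Tmax := by positivity
    linarith
  calc (stdGaussian (Fin n)).real {x | d.tuning 1 α < d.V x}
      ≤ (stdGaussian (Fin n)).real ((⋃ j, A j) ∪ B) := measureReal_mono hsub
    _ ≤ (stdGaussian (Fin n)).real (⋃ j, A j) + (stdGaussian (Fin n)).real B :=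
        measureReal_union_le _ _
    _ ≤ ∑ j, (stdGaussian (Fin n)).real (A j) + (stdGaussian (Fin n)).real B := by
        gcongr
        exact measureReal_iUnion_fintype_le _
    _ ≤ ∑ _j : Fin q, α / (2 * q) + α / (2 * q) := by
        gcongr with j
        exact hA j
    _ = (q * α + α) / (2 * q) := by
        rw [Finset.sum_const, Finset.card_univ, Fintype.card_fin, nsmul_eq_mul]
        ring
    _ ≤ α := by
        rw [div_le_iff₀ (by positivity)]
        nlinarith

/-! ### Transfer to the probability space of the noise -/

section Probability

variable {Ω : Type*} [MeasurableSpace Ω] {P : Measure Ω} [IsProbabilityMeasure P]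
  {ε : Fin n → Ω → ℝ} {α lam c : ℝ}

theorem measurableSet_V_le (hm : ∀ i, Measurable (ε i)) (r : ℝ) :
    MeasurableSet {ω | d.V (fun i => ε i ω) ≤ r} :=
  measurableSet_le (d.measurable_V.comp (measurable_pi_lambda _ hm)) measurable_const

theorem real_V_le_ge (hm : ∀ i, Measurable (ε i))
    (hg : ∀ i, P.map (ε i) = gaussianReal 0 1) (hi : iIndepFun ε P)
    (hq : 0 < q) (hα0 : 0 < α) (hα1 : α < 1) (hT : ∀ j, d.T j < n)
    (hlog : 16 * Real.log (2 * q / α) ≤ (n : ℝ) - d.Tmax) (hc : 0 < c)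
    (hlam : d.tuning c α ≤ lam) :
    1 - α ≤ P.real {ω | d.V (fun i => ε i ω) ≤ lam / c} := by
  have h1 : d.tuning 1 α ≤ lam / c := by
    rw [le_div_iff₀ hc, mul_comm, ← d.tuning_eq_mul]
    exact hlam
  have h2 : {ω | d.V (fun i => ε i ω) ≤ lam / c}ᶜ ⊆
      {ω | (fun i => ε i ω) ∈ {x | d.tuning 1 α < d.V x}} := fun ω hω =>
    h1.trans_lt (not_le.1 hω)
  have h3 := (measureReal_mono (μ := P) h2).trans_eq (stdGaussian_real_preimage hm hg hi
    (measurableSet_lt measurable_const d.measurable_V))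
  rw [probReal_compl_eq_one_sub (d.measurableSet_V_le hm _)] at h3
  linarith [d.stdGaussian_tuning_lt_V hq hα0 hα1 hT hlog]

theorem withProb_of_V_le_of_noise_level (hm : ∀ i, Measurable (ε i))
    (hg : ∀ i, P.map (ε i) = gaussianReal 0 1) (hi : iIndepFun ε P)
    (hq : 0 < q) (hα0 : 0 < α) (hα1 : α < 1) (hT : ∀ j, d.T j < n)
    (hlog : 16 * Real.log (2 * q / α) ≤ (n : ℝ) - d.Tmax) (hc : 0 < c)
    (hlam : d.tuning c α ≤ lam) {Q : Ω → Prop}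
    (hQ : ∀ ω, d.V (fun i => ε i ω) ≤ lam / c →
      l2 (fun i => ε i ω) ^ 2 ≤ n * (1 + tdev n α) → Q ω) :
    WithProb P (1 - 2 * α) Q := by
  have hn : 0 < n := Nat.zero_lt_of_lt (hT ⟨0, hq⟩)
  set A := {ω | d.V (fun i => ε i ω) ≤ lam / c} with hA
  set B := {ω | (fun i => ε i ω) ∈ {x : Fin n → ℝ | (n : ℝ) * (1 + tdev n α) ≤ l2 x ^ 2}} with hB
  have hl : Measurable fun x : Fin n → ℝ => l2 x ^ 2 := measurable_l2.pow_const 2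
  have hBm : MeasurableSet B :=
    measurableSet_le measurable_const (hl.comp (measurable_pi_lambda _ hm))
  refine ⟨A ∩ Bᶜ, (d.measurableSet_V_le hm _).inter hBm.compl, ?_, fun ω hω =>
    hQ ω hω.1 (le_of_not_ge fun h => hω.2 h)⟩
  have h1 := d.real_V_le_ge hm hg hi hq hα0 hα1 hT hlog hc hlam
  have h2 : P.real B ≤ α := (stdGaussian_real_preimage hm hg hi
    (measurableSet_le measurable_const hl)).trans_le (stdGaussian_noise_level hn hα0 hα1)
  have h3 : P.real A ≤ P.real (A ∩ Bᶜ) + P.real B := by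
    refine (measureReal_mono (fun ω hω => ?_)).trans (measureReal_union_le _ _)
    by_cases h : ω ∈ B
    · exact Or.inr h
    · exact Or.inl ⟨hω, h⟩
  linarith

end Probability

end Design

/-! ### Decomposition of vectors into groups -/

section Blocks

variable {ι : Type*} {q : ℕ} (label : ι → Fin q)

theorem block_add (v w : ι → ℝ) (j : Fin q) :
    block label (v + w) j = block label v j + block label w j := rfl

theorem block_sub (v w : ι → ℝ) (j : Fin q) :
    block label (v - w) j = block label v j - block label w j := rfl

theorem block_smul (c : ℝ) (v : ι → ℝ) (j : Fin q) :
    block label (c • v) j = c • block label v j := rfl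

@[simp] theorem block_zero (j : Fin q) : block label (0 : ι → ℝ) j = 0 := rfl

theorem continuous_block (j : Fin q) : Continuous fun v : ι → ℝ => block label v j := by
  unfold block
  fun_prop

variable [Fintype ι]

theorem sum_sum_block (f : ι → ℝ) : ∑ j, ∑ i, block label f j i = ∑ i, f i := by
  rw [← Finset.sum_fiberwise Finset.univ label]
  refine Finset.sum_congr rfl fun j _ => ?_
  rw [Finset.sum_subtype (p := fun i => label i = j) _ (by simp)]
  rfl

theorem dotProduct_eq_sum_block (v w : ι → ℝ) :
    v ⬝ᵥ w = ∑ j, block label v j ⬝ᵥ block label w j :=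
  (sum_sum_block label fun i => v i * w i).symm

end Blocks

/-! ### Prediction and estimation for a fixed noise vector -/

namespace Design

variable {n p q : ℕ} (d : Design n p q)

theorem groupNorm_nonneg (J : Finset (Fin q)) (β : Fin p → ℝ) : 0 ≤ d.groupNorm J β :=
  Finset.sum_nonneg fun _ _ => mul_nonneg (Real.sqrt_nonneg _) (l2_nonneg _)

theorem groupNorm_add_le (J : Finset (Fin q)) (β δ : Fin p → ℝ) :
    d.groupNorm J (β + δ) ≤ d.groupNorm J β + d.groupNorm J δ := by
  unfold groupNorm
  rw [← Finset.sum_add_distrib]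
  refine Finset.sum_le_sum fun j _ => ?_
  rw [← mul_add, block_add]
  exact mul_le_mul_of_nonneg_left (l2_add_le _ _) (Real.sqrt_nonneg _)

theorem groupNorm_smul (J : Finset (Fin q)) (c : ℝ) (β : Fin p → ℝ) :
    d.groupNorm J (c • β) = |c| * d.groupNorm J β := by
  unfold groupNorm
  rw [Finset.mul_sum]
  refine Finset.sum_congr rfl fun j _ => ?_
  rw [block_smul, l2_smul]
  ring

theorem groupNorm_neg (J : Finset (Fin q)) (β : Fin p → ℝ) :
    d.groupNorm J (-β) = d.groupNorm J β := by
  simpa using d.groupNorm_smul J (-1) β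

theorem groupNorm_add_compl (J : Finset (Fin q)) (β : Fin p → ℝ) :
    d.groupNorm J β + d.groupNorm Jᶜ β = d.groupNorm Finset.univ β :=
  Finset.sum_add_sum_compl _ _

theorem groupNorm_eq_zero_of_block {J : Finset (Fin q)} {β : Fin p → ℝ}
    (h : ∀ j ∈ J, block d.label β j = 0) : d.groupNorm J β = 0 :=
  Finset.sum_eq_zero fun j hj => by rw [h j hj, l2_zero, mul_zero]

theorem eq_zero_of_groupNorm_le {β : Fin p → ℝ} (h : d.groupNorm Finset.univ β ≤ 0) : β = 0 := by
  have h0 := h.antisymm (d.groupNorm_nonneg _ _)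
  unfold groupNorm at h0
  rw [Finset.sum_eq_zero_iff_of_nonneg
    fun j _ => mul_nonneg (Real.sqrt_nonneg _) (l2_nonneg _)] at h0
  ext k
  have hT : √(d.T (d.label k) : ℝ) ≠ 0 :=
    (Real.sqrt_pos.2 (by exact_mod_cast d.T_pos (d.label k))).ne'
  have := (mul_eq_zero.1 (h0 (d.label k) (Finset.mem_univ _))).resolve_left hT
  exact congrFun (l2_eq_zero.1 this) ⟨k, rfl⟩

theorem mem_active {β : Fin p → ℝ} {j : Fin q} : j ∈ d.active β ↔ block d.label β j ≠ 0 := by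
  classical
  simp [active]

theorem block_eq_zero_of_notMem_active {β : Fin p → ℝ} {j : Fin q} (h : j ∉ d.active β) :
    block d.label β j = 0 := by
  rwa [mem_active, not_not] at h

theorem groupNorm_compl_active (β : Fin p → ℝ) : d.groupNorm (d.active β)ᶜ β = 0 :=
  d.groupNorm_eq_zero_of_block fun _ hj =>
    d.block_eq_zero_of_notMem_active (Finset.mem_compl.1 hj)

/-- The noise event for a noise vector `w`: all score blocks are at most `B √T_j ‖w‖₂ / √n`. -/
def NoiseBound (B : ℝ) (w : Fin n → ℝ) : Prop :=
  ∀ j, √(n : ℝ) * l2 (block d.label (d.X.transpose.mulVec w) j) ≤ B * (√(d.T j : ℝ) * l2 w)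

variable {d}

/-- Both sides of the noise bound are homogeneous in the noise, so `σ` cancels without being assumed
nonzero. -/
theorem NoiseBound.of_V_le {B σ : ℝ} {e : Fin n → ℝ} (h : d.V e ≤ B) :
    d.NoiseBound B (σ • e) := by
  intro j
  rw [Matrix.mulVec_smul, block_smul, l2_smul, l2_smul]
  have h1 := (d.l2_block_le_V e j).trans (mul_le_mul_of_nonneg_right h
    (mul_nonneg (Real.sqrt_nonneg _) (l2_nonneg _)))
  have := mul_le_mul_of_nonneg_left h1 (abs_nonneg σ)
  linarith

theorem NoiseBound.dotProduct_le {B : ℝ} {w : Fin n → ℝ} (h : d.NoiseBound B w)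
    (δ : Fin p → ℝ) :
    √(n : ℝ) * (w ⬝ᵥ d.X.mulVec δ) ≤ B * l2 w * d.groupNorm Finset.univ δ := by
  rw [Matrix.dotProduct_mulVec, ← Matrix.mulVec_transpose, dotProduct_eq_sum_block d.label,
    Finset.mul_sum, groupNorm, Finset.mul_sum]
  refine Finset.sum_le_sum fun j _ => ?_
  calc √(n : ℝ) * (block d.label (d.X.transpose.mulVec w) j ⬝ᵥ block d.label δ j)
      ≤ √(n : ℝ) * (l2 (block d.label (d.X.transpose.mulVec w) j) * l2 (block d.label δ j)) :=
        mul_le_mul_of_nonneg_left (dotProduct_le_l2_mul_l2 _ _) (Real.sqrt_nonneg _)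
    _ = √(n : ℝ) * l2 (block d.label (d.X.transpose.mulVec w) j) * l2 (block d.label δ j) := by
        ring
    _ ≤ B * (√(d.T j : ℝ) * l2 w) * l2 (block d.label δ j) :=
        mul_le_mul_of_nonneg_right (h j) (l2_nonneg _)
    _ = _ := by ring

theorem l2_sub_mulVec_sq (w : Fin n → ℝ) (δ : Fin p → ℝ) :
    l2 (w - d.X.mulVec δ) ^ 2
      = l2 w ^ 2 - 2 * (w ⬝ᵥ d.X.mulVec δ) + l2 (d.X.mulVec δ) ^ 2 := by
  simp only [l2_sq_eq_dotProduct, sub_dotProduct, dotProduct_sub]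
  rw [dotProduct_comm (d.X.mulVec δ) w]
  ring

/-- Convexity of the norm at `w`: Cauchy–Schwarz for `w` and `w - Xδ` gives `‖w‖ (‖w‖ - ‖w - Xδ‖) ≤
⟨w, Xδ⟩`, and the noise bound controls the right side. The case `w = 0` has no division and is
treated apart. -/
theorem NoiseBound.residual_ge {B : ℝ} {w : Fin n → ℝ} (h : d.NoiseBound B w) (hB : 0 ≤ B)
    (δ : Fin p → ℝ) :
    √(n : ℝ) * (l2 w - l2 (w - d.X.mulVec δ)) ≤ B * d.groupNorm Finset.univ δ := by
  rcases (l2_nonneg w).eq_or_lt with h0 | h0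
  · rw [← h0]
    have := mul_nonneg (Real.sqrt_nonneg (n : ℝ)) (l2_nonneg (w - d.X.mulVec δ))
    have := mul_nonneg hB (d.groupNorm_nonneg Finset.univ δ)
    linarith
  · have h1 := dotProduct_le_l2_mul_l2 w (w - d.X.mulVec δ)
    rw [dotProduct_sub, ← l2_sq_eq_dotProduct] at h1
    have h2 := h.dotProduct_le δ
    refine le_of_mul_le_mul_left ?_ h0
    have h3 := mul_le_mul_of_nonneg_left h1 (Real.sqrt_nonneg (n : ℝ))
    nlinarith

variable {lam : ℝ} {w : Fin n → ℝ} {β b : Fin p → ℝ}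

theorem residual_eq : d.X.mulVec β + w - d.X.mulVec b = w - d.X.mulVec (b - β) := by
  rw [Matrix.mulVec_sub]
  abel

theorem criterion_le_iff (d : Design n p q) (hn : 0 < n) (lam : ℝ) (Y : Fin n → ℝ)
    (b b' : Fin p → ℝ) :
    d.criterion lam Y b ≤ d.criterion lam Y b' ↔
      √(n : ℝ) * l2 (Y - d.X.mulVec b) + lam * d.groupNorm Finset.univ b
        ≤ √(n : ℝ) * l2 (Y - d.X.mulVec b') + lam * d.groupNorm Finset.univ b' := by
  have hn' : (0 : ℝ) < n := by exact_mod_cast hn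
  have e : ∀ β, √(n : ℝ) * l2 (Y - d.X.mulVec β) + lam * d.groupNorm Finset.univ β
      = n * d.criterion lam Y β := by
    intro β
    unfold criterion
    calc _ = (n : ℝ) / √(n : ℝ) * l2 (Y - d.X.mulVec β)
          + (n : ℝ) / n * lam * d.groupNorm Finset.univ β := by
          rw [Real.div_sqrt, div_self hn'.ne', one_mul]
      _ = _ := by ring
  rw [e, e, mul_le_mul_iff_right₀ hn']

theorem IsEstimator.residual_le (hn : 0 < n)
    (hb : d.IsEstimator lam (d.X.mulVec β + w) b) :
    √(n : ℝ) * (l2 (w - d.X.mulVec (b - β)) - l2 w)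
      ≤ lam * (d.groupNorm Finset.univ β - d.groupNorm Finset.univ b) := by
  have h := (d.criterion_le_iff hn _ _ _ _).1 (hb β)
  rw [residual_eq, add_sub_cancel_left] at h
  linarith

/-- The triangle inequality on the active groups; on the others `β` vanishes and the penalty of `b`
is that of the error. -/
theorem groupNorm_sub_le_of_active (β b : Fin p → ℝ) :
    d.groupNorm Finset.univ β - d.groupNorm Finset.univ b
      ≤ d.groupNorm (d.active β) (b - β) - d.groupNorm (d.active β)ᶜ (b - β) := by
  rw [← d.groupNorm_add_compl (d.active β) β, ← d.groupNorm_add_compl (d.active β) b,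
    d.groupNorm_compl_active]
  have h1 := d.groupNorm_add_le (d.active β) b (-(b - β))
  rw [groupNorm_neg, show b + -(b - β) = β by abel] at h1
  have h2 := d.groupNorm_add_le (d.active β)ᶜ b (-β)
  rw [groupNorm_neg, d.groupNorm_compl_active, ← sub_eq_add_neg] at h2
  linarith

/-- Minimality bounds the change of the residual norm above by `λ(a - c)`, and convexity bounds it
below by `-B(a + c)`, up to the common factor `√n`. Hence `c(λ - B) ≤ a(λ + B)`, and the condition
on `B` says that this ratio is at most `γ`. -/
theorem IsEstimator.cone {B γ : ℝ} (hn : 0 < n) (hlam : 0 < lam) (hB : 0 ≤ B)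
    (hγ : 1 < γ) (hBγ : B * (γ + 1) ≤ lam * (γ - 1)) (hw : d.NoiseBound B w)
    (hb : d.IsEstimator lam (d.X.mulVec β + w) b) :
    d.groupNorm (d.active β)ᶜ (b - β) ≤ γ * d.groupNorm (d.active β) (b - β) := by
  have h1 := hb.residual_le hn
  have h2 := hw.residual_ge hB (b - β)
  rw [← d.groupNorm_add_compl (d.active β)] at h2
  have h3 := mul_le_mul_of_nonneg_left (d.groupNorm_sub_le_of_active β b) hlam.le
  have ha := d.groupNorm_nonneg (d.active β) (b - β)
  have hc := d.groupNorm_nonneg (d.active β)ᶜ (b - β)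
  set a := d.groupNorm (d.active β) (b - β)
  set c := d.groupNorm (d.active β)ᶜ (b - β)
  have h4 : c * (lam - B) ≤ a * (lam + B) := by nlinarith
  have h5 : c * (lam * 2) ≤ a * (lam * (2 * γ)) := by
    have e1 := mul_le_mul_of_nonneg_left h4 (show 0 ≤ γ + 1 by linarith)
    have e2 := mul_le_mul_of_nonneg_left hBγ hc
    have e3 := mul_le_mul_of_nonneg_left hBγ ha
    nlinarith
  refine le_of_mul_le_mul_left (a := lam * 2) ?_ (by positivity)
  linarith

theorem one_sub_pos_of_sstar_lt {S : Finset (Fin q)} {κ : ℝ} (hn : 0 < n) (hκ : 0 < κ)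
    (hlam : 0 < lam) (hs : (d.sstar S : ℝ) < (n : ℝ) ^ 2 * κ ^ 2 / lam ^ 2) :
    0 < 1 - lam ^ 2 * d.sstar S / ((n : ℝ) ^ 2 * κ ^ 2) := by
  have hn' : (0 : ℝ) < n := by exact_mod_cast hn
  rw [lt_div_iff₀ (by positivity)] at hs
  rw [sub_pos, div_lt_one (by positivity)]
  linarith

theorem u_nonneg {S : Finset (Fin q)} {κ γ : ℝ} (hn : 0 < n) (hκ : 0 < κ) (hγ : 1 < γ)
    (hlam : 0 < lam) (hs : (d.sstar S : ℝ) < (n : ℝ) ^ 2 * κ ^ 2 / lam ^ 2) :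
    0 ≤ d.u S κ γ lam :=
  div_nonneg (by linarith) (one_sub_pos_of_sstar_lt hn hκ hlam hs).le

/-- The prediction bound in terms of the norm of the realized noise. -/
theorem IsEstimator.l2_mulVec_le {B κ γ : ℝ} (hn : 0 < n) (hlam : 0 < lam) (hB : 0 ≤ B)
    (hC : d.Compat (d.active β) κ γ) (hBγ : B * (γ + 1) ≤ lam * (γ - 1))
    (hs : (d.sstar (d.active β) : ℝ) < (n : ℝ) ^ 2 * κ ^ 2 / lam ^ 2)
    (hw : d.NoiseBound B w) (hb : d.IsEstimator lam (d.X.mulVec β + w) b) :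
    l2 (d.X.mulVec (b - β)) ≤ d.u (d.active β) κ γ lam *
      (lam * √(d.sstar (d.active β) : ℝ) / (κ * n)) * l2 w := by
  obtain ⟨hκ, hγ, hcomp⟩ := hC
  have hn' : (0 : ℝ) < n := by exact_mod_cast hn
  have hcone := hb.cone hn hlam hB hγ hBγ hw
  have hac := hcomp _ hcone
  have h1 := hb.residual_le hn
  have h2 := hw.dotProduct_le (b - β)
  have h3 := mul_le_mul_of_nonneg_left (d.groupNorm_sub_le_of_active β b) hlam.le
  have h4 := d.l2_sub_mulVec_sq w (b - β)
  have hpos := one_sub_pos_of_sstar_lt hn hκ hlam hs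
  rw [← d.groupNorm_add_compl (d.active β)] at h2
  have ha := d.groupNorm_nonneg (d.active β) (b - β)
  have hc := d.groupNorm_nonneg (d.active β)ᶜ (b - β)
  have hx := l2_nonneg (d.X.mulVec (b - β))
  have hE := l2_nonneg w
  have hr := l2_nonneg (w - d.X.mulVec (b - β))
  have hu : d.u (d.active β) κ γ lam = 2 * γ /
    (1 - lam ^ 2 * d.sstar (d.active β) / ((n : ℝ) ^ 2 * κ ^ 2)) := rfl
  have hss : √(d.sstar (d.active β) : ℝ) ^ 2 = d.sstar (d.active β) :=
    Real.sq_sqrt (by positivity)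
  have hSS := Real.sqrt_nonneg (d.sstar (d.active β) : ℝ)
  have hR : 0 < √(n : ℝ) := Real.sqrt_pos.2 hn'
  have hRn : √(n : ℝ) ^ 2 = n := Real.sq_sqrt hn'.le
  set a := d.groupNorm (d.active β) (b - β)
  set c := d.groupNorm (d.active β)ᶜ (b - β)
  set x := l2 (d.X.mulVec (b - β))
  set E := l2 w
  set r := l2 (w - d.X.mulVec (b - β))
  set R := √(n : ℝ)
  set D := w ⬝ᵥ d.X.mulVec (b - β)
  set S := √(d.sstar (d.active β) : ℝ)
  have k1 : R * (r - E) ≤ lam * a := by nlinarith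
  have k2 : R * D ≤ lam * (γ - 1) * E * a := by
    have e1 : B * E * (a + c) ≤ B * E * ((γ + 1) * a) :=
      mul_le_mul_of_nonneg_left (by linarith) (mul_nonneg hB hE)
    have e2 := mul_le_mul_of_nonneg_right hBγ (mul_nonneg hE ha)
    nlinarith
  have k3 : R ^ 2 * (r ^ 2 - E ^ 2) ≤ lam * a * (2 * R * E + lam * a) := by
    have e1 : R * (r + E) ≤ 2 * R * E + lam * a := by linarith
    calc R ^ 2 * (r ^ 2 - E ^ 2) = R * (r - E) * (R * (r + E)) := by ring
      _ ≤ lam * a * (R * (r + E)) := mul_le_mul_of_nonneg_right k1 (by positivity)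
      _ ≤ _ := mul_le_mul_of_nonneg_left e1 (by positivity)
  -- Expanding the square gives `x² = (r² - E²) + 2⟨w, Xδ⟩`. The two terms contribute `2λREa` and
  -- `2(γ - 1)λREa`, which add up to the factor `2γ`.
  have k4 : R ^ 2 * x ^ 2 ≤ 2 * γ * lam * R * E * a + lam ^ 2 * a ^ 2 := by
    have e1 := mul_le_mul_of_nonneg_left k2 (show 0 ≤ 2 * R by positivity)
    calc R ^ 2 * x ^ 2 = R ^ 2 * (r ^ 2 - E ^ 2) + 2 * R * (R * D) := by rw [h4]; ring
      _ ≤ lam * a * (2 * R * E + lam * a) + 2 * R * (lam * (γ - 1) * E * a) := add_le_add k3 e1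
      _ = _ := by ring
  rw [le_div_iff₀ (by positivity)] at hac
  have k5 : a * (R * κ) ≤ S * x := hac
  have k6 : R ^ 4 * κ ^ 2 * x ^ 2 ≤
      2 * γ * lam * R ^ 2 * κ * E * (S * x) + lam ^ 2 * (S * x) ^ 2 := by
    have e1 := mul_le_mul_of_nonneg_left k4 (show 0 ≤ R ^ 2 * κ ^ 2 by positivity)
    have e2 := mul_le_mul_of_nonneg_left k5 (show 0 ≤ 2 * γ * lam * R ^ 2 * κ * E by positivity)
    have e3 := mul_le_mul_of_nonneg_left
      (pow_le_pow_left₀ (show 0 ≤ a * (R * κ) by positivity) k5 2) (sq_nonneg lam)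
    calc R ^ 4 * κ ^ 2 * x ^ 2 = R ^ 2 * κ ^ 2 * (R ^ 2 * x ^ 2) := by ring
      _ ≤ R ^ 2 * κ ^ 2 * (2 * γ * lam * R * E * a + lam ^ 2 * a ^ 2) := e1
      _ = 2 * γ * lam * R ^ 2 * κ * E * (a * (R * κ)) + lam ^ 2 * (a * (R * κ)) ^ 2 := by ring
      _ ≤ _ := add_le_add e2 e3
  -- Compatibility has turned every `a` into a multiple of `x`, so for `x > 0` one factor `x`
  -- cancels and a linear inequality remains.
  rcases hx.eq_or_lt with hx0 | hx0
  · rw [← hx0, hu]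
    positivity
  have k7 : (R ^ 4 * κ ^ 2 - lam ^ 2 * S ^ 2) * x ≤ 2 * γ * lam * R ^ 2 * κ * E * S := by
    refine le_of_mul_le_mul_right ?_ hx0
    linarith
  rw [hss, show R ^ 4 = (R ^ 2) ^ 2 by ring, hRn] at k7
  have k8 : (1 - lam ^ 2 * d.sstar (d.active β) / ((n : ℝ) ^ 2 * κ ^ 2)) * x
      ≤ 2 * γ * (lam * S / (κ * n)) * E := by
    calc _ = (((n : ℝ) ^ 2 * κ ^ 2 - lam ^ 2 * d.sstar (d.active β)) * x)
          / ((n : ℝ) ^ 2 * κ ^ 2) := by field_simp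
      _ ≤ (2 * γ * lam * n * κ * E * S) / ((n : ℝ) ^ 2 * κ ^ 2) := by gcongr
      _ = _ := by field_simp
  rw [hu]
  calc x ≤ (2 * γ * (lam * S / (κ * n)) * E) /
        (1 - lam ^ 2 * d.sstar (d.active β) / ((n : ℝ) ^ 2 * κ ^ 2)) := by
        rw [le_div_iff₀ hpos]
        linarith
    _ = _ := by ring

/-- The estimation bound in terms of the norm of the realized noise. -/
theorem IsEstimator.groupNorm_le {B κ γ : ℝ} (hn : 0 < n) (hlam : 0 < lam) (hB : 0 ≤ B)
    (hC : d.Compat (d.active β) κ γ) (hBγ : B * (γ + 1) ≤ lam * (γ - 1))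
    (hs : (d.sstar (d.active β) : ℝ) < (n : ℝ) ^ 2 * κ ^ 2 / lam ^ 2)
    (hw : d.NoiseBound B w) (hb : d.IsEstimator lam (d.X.mulVec β + w) b) :
    d.groupNorm Finset.univ (b - β) ≤ (γ + 1) * d.u (d.active β) κ γ lam *
      (lam * d.sstar (d.active β) / (κ ^ 2 * n)) * (l2 w / √(n : ℝ)) := by
  have hn' : (0 : ℝ) < n := by exact_mod_cast hn
  have hκ := hC.1
  have hγ := hC.2.1
  have hcone := hb.cone hn hlam hB hγ hBγ hw
  have hac := hC.2.2 _ hcone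
  have hx := hb.l2_mulVec_le hn hlam hB hC hBγ hs hw
  have hR : 0 < √(n : ℝ) := Real.sqrt_pos.2 hn'
  have hss : √(d.sstar (d.active β) : ℝ) * √(d.sstar (d.active β) : ℝ) = d.sstar (d.active β) :=
    Real.mul_self_sqrt (by positivity)
  rw [← d.groupNorm_add_compl (d.active β)]
  calc _ ≤ (γ + 1) * d.groupNorm (d.active β) (b - β) := by linarith
    _ ≤ (γ + 1) * (√(d.sstar (d.active β) : ℝ) * (d.u (d.active β) κ γ lam *
      (lam * √(d.sstar (d.active β) : ℝ) / (κ * n)) * l2 w) / (√(n : ℝ) * κ)) := by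
        refine mul_le_mul_of_nonneg_left (hac.trans ?_) (by linarith)
        gcongr
    _ = (γ + 1) * d.u (d.active β) κ γ lam * (lam * (√(d.sstar (d.active β) : ℝ) *
        √(d.sstar (d.active β) : ℝ)) / (κ ^ 2 * n)) * (l2 w / √(n : ℝ)) := by
        field_simp
    _ = _ := by rw [hss]

theorem IsEstimator.predictionBounds {B κ γ α σ : ℝ} {e : Fin n → ℝ} (hn : 0 < n)
    (hlam : 0 < lam) (hB : 0 ≤ B) (hσ : 0 ≤ σ)
    (hC : d.Compat (d.active β) κ γ) (hBγ : B * (γ + 1) ≤ lam * (γ - 1))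
    (hs : (d.sstar (d.active β) : ℝ) < (n : ℝ) ^ 2 * κ ^ 2 / lam ^ 2)
    (hw : d.NoiseBound B (σ • e)) (he : l2 e ≤ √(n : ℝ) * √(1 + tdev n α))
    (hb : d.IsEstimator lam (d.response β σ e) b) :
    d.PredictionBounds α κ γ σ lam β b := by
  have hn' : (0 : ℝ) < n := by exact_mod_cast hn
  have hκ := hC.1
  have hγ := hC.2.1
  have hu := u_nonneg hn hκ hγ hlam hs
  have hR : 0 < √(n : ℝ) := Real.sqrt_pos.2 hn'
  have hE : l2 (σ • e) ≤ σ * (√(n : ℝ) * √(1 + tdev n α)) := by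
    rw [l2_smul, abs_of_nonneg hσ]
    exact mul_le_mul_of_nonneg_left he hσ
  constructor
  · refine (hb.l2_mulVec_le hn hlam hB hC hBγ hs hw).trans ?_
    refine (mul_le_mul_of_nonneg_left hE (by positivity)).trans_eq ?_
    nth_rewrite 1 [← Real.mul_self_sqrt hn'.le]
    field_simp
  · refine (hb.groupNorm_le hn hlam hB hC hBγ hs hw).trans ?_
    have hE' : l2 (σ • e) / √(n : ℝ) ≤ σ * √(1 + tdev n α) := by
      rw [div_le_iff₀ hR]
      linarith
    refine (mul_le_mul_of_nonneg_left hE' ?_).trans_eq ?_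
    · have : 0 ≤ γ + 1 := by linarith
      positivity
    · field_simp

/-- The criterion is continuous and coercive and so has a minimizer over any nonempty closed
set. -/
theorem exists_isMinOn_criterion (d : Design n p q) (hn : 0 < n) (hlam : 0 < lam)
    (Y : Fin n → ℝ) {s : Set (Fin p → ℝ)} (hs : IsClosed s) (h0 : 0 ∈ s) :
    ∃ b ∈ s, ∀ b' ∈ s, d.criterion lam Y b ≤ d.criterion lam Y b' := by
  have hn' : (0 : ℝ) < n := by exact_mod_cast hn
  have hcont : Continuous (d.criterion lam Y) := by
    unfold criterion groupNorm
    refine ((continuous_l2.comp ?_).div_const _).add (continuous_const.mul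
      (continuous_finsetSum _ fun j _ => continuous_const.mul
        (continuous_l2.comp (continuous_block _ j))))
    fun_prop
  have hbound : ∀ β : Fin p → ℝ, lam / n * ‖β‖ ≤ d.criterion lam Y β := by
    intro β
    have h1 : ‖β‖ ≤ d.groupNorm Finset.univ β := by
      refine (pi_norm_le_iff_of_nonneg (d.groupNorm_nonneg _ _)).2 fun k => ?_
      have hT : 1 ≤ √(d.T (d.label k) : ℝ) :=
        Real.one_le_sqrt.2 (by exact_mod_cast d.T_pos (d.label k))
      have h2 : ‖β k‖ ≤ l2 (block d.label β (d.label k)) := by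
        simpa [block, l2] using PiLp.norm_apply_le
          (WithLp.toLp 2 (block d.label β (d.label k))) ⟨k, rfl⟩
      have h3 : √(d.T (d.label k) : ℝ) * l2 (block d.label β (d.label k))
          ≤ d.groupNorm Finset.univ β :=
        Finset.single_le_sum (f := fun j => √(d.T j : ℝ) * l2 (block d.label β j))
          (fun j _ => mul_nonneg (Real.sqrt_nonneg _) (l2_nonneg _)) (Finset.mem_univ _)
      nlinarith [l2_nonneg (block d.label β (d.label k))]
    have h2 : 0 ≤ l2 (Y - d.X.mulVec β) / √(n : ℝ) := div_nonneg (l2_nonneg _) (Real.sqrt_nonneg _)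
    have h3 := mul_le_mul_of_nonneg_left h1 (show 0 ≤ lam / n by positivity)
    unfold criterion
    linarith
  have htop : Filter.Tendsto (d.criterion lam Y) (Filter.cocompact _) Filter.atTop :=
    Filter.tendsto_atTop_mono hbound (tendsto_norm_cocompact_atTop.const_mul_atTop (by positivity))
  obtain ⟨b, hb, hmin⟩ := hcont.continuousOn.exists_isMinOn' hs h0
    (Filter.Eventually.filter_mono inf_le_left
      (htop.eventually (Filter.eventually_ge_atTop (d.criterion lam Y 0))))
  exact ⟨b, hb, fun b' hb' => hmin hb'⟩

theorem exists_isEstimator (d : Design n p q) (hn : 0 < n) (hlam : 0 < lam) (Y : Fin n → ℝ) :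
    ∃ b, d.IsEstimator lam Y b := by
  obtain ⟨b, -, hb⟩ := d.exists_isMinOn_criterion hn hlam Y isClosed_univ (Set.mem_univ 0)
  exact ⟨b, fun β => hb β (Set.mem_univ β)⟩

end Design

/-! ### Minimization over a fixed support and first-order conditions -/

namespace Design

variable {n p q : ℕ} (d : Design n p q)

/-- The coefficient vectors that vanish outside the groups in `S`. -/
def supportedOn (S : Finset (Fin q)) : Set (Fin p → ℝ) :=
  {h | ∀ j ∉ S, block d.label h j = 0}

/-- The coordinates of `b` in the groups of `S`, completed by zeros. -/
def restrict (S : Finset (Fin q)) (b : Fin p → ℝ) : Fin p → ℝ :=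
  fun k => if d.label k ∈ S then b k else 0

theorem block_restrict_of_mem {S : Finset (Fin q)} {j : Fin q} (hj : j ∈ S) (b : Fin p → ℝ) :
    block d.label (d.restrict S b) j = block d.label b j := by
  ext ⟨k, hk⟩
  subst hk
  simp [block, restrict, hj]

theorem block_restrict_of_notMem {S : Finset (Fin q)} {j : Fin q} (hj : j ∉ S) (b : Fin p → ℝ) :
    block d.label (d.restrict S b) j = 0 := by
  ext ⟨k, hk⟩
  subst hk
  simp [block, restrict, hj]

theorem restrict_mem_supportedOn (S : Finset (Fin q)) (b : Fin p → ℝ) :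
    d.restrict S b ∈ d.supportedOn S := fun _ hj => d.block_restrict_of_notMem hj b

theorem restrict_add_restrict_compl (S : Finset (Fin q)) (b : Fin p → ℝ) :
    d.restrict S b + d.restrict Sᶜ b = b := by
  ext k
  by_cases h : d.label k ∈ S <;> simp [restrict, h]

theorem groupNorm_restrict (S : Finset (Fin q)) (b : Fin p → ℝ) :
    d.groupNorm Finset.univ (d.restrict S b) = d.groupNorm S b := by
  rw [← d.groupNorm_add_compl S, d.groupNorm_eq_zero_of_block (J := Sᶜ) fun j hj =>
    d.block_restrict_of_notMem (Finset.mem_compl.1 hj) b, add_zero]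
  exact Finset.sum_congr rfl fun j hj => by rw [d.block_restrict_of_mem hj]

theorem apply_eq_zero_of_mem_supportedOn {S : Finset (Fin q)} {h : Fin p → ℝ}
    (hh : h ∈ d.supportedOn S) {k : Fin p} (hk : d.label k ∉ S) : h k = 0 :=
  congrFun (hh _ hk) ⟨k, rfl⟩

theorem isClosed_supportedOn (S : Finset (Fin q)) : IsClosed (d.supportedOn S) := by
  have : d.supportedOn S = ⋂ j, ⋂ _ : j ∉ S, {h | block d.label h j = 0} := by
    ext h
    simp [supportedOn]
  rw [this]
  exact isClosed_iInter fun j => isClosed_iInter fun _ =>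
    isClosed_eq (continuous_block d.label j) continuous_const

theorem zero_mem_supportedOn (S : Finset (Fin q)) : (0 : Fin p → ℝ) ∈ d.supportedOn S :=
  fun _ _ => rfl

theorem add_mem_supportedOn {S : Finset (Fin q)} {g h : Fin p → ℝ} (hg : g ∈ d.supportedOn S)
    (hh : h ∈ d.supportedOn S) : g + h ∈ d.supportedOn S := fun j hj => by
  rw [block_add, hg j hj, hh j hj, add_zero]

theorem smul_mem_supportedOn {S : Finset (Fin q)} (c : ℝ) {h : Fin p → ℝ}
    (hh : h ∈ d.supportedOn S) : c • h ∈ d.supportedOn S := fun j hj => by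
  rw [block_smul, hh j hj, smul_zero]

theorem sub_mem_supportedOn {S : Finset (Fin q)} {g h : Fin p → ℝ} (hg : g ∈ d.supportedOn S)
    (hh : h ∈ d.supportedOn S) : g - h ∈ d.supportedOn S := fun j hj => by
  rw [block_sub, hg j hj, hh j hj, sub_zero]

theorem mem_supportedOn_active (β : Fin p → ℝ) : β ∈ d.supportedOn (d.active β) :=
  fun _ hj => d.block_eq_zero_of_notMem_active hj

/-- `b` minimizes the criterion over the coefficient vectors supported on `S`. -/
def IsRestrictedMin (lam : ℝ) (Y : Fin n → ℝ) (S : Finset (Fin q)) (b : Fin p → ℝ) : Prop :=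
  b ∈ d.supportedOn S ∧ ∀ b' ∈ d.supportedOn S, d.criterion lam Y b ≤ d.criterion lam Y b'

variable {d} {lam : ℝ} {Y w : Fin n → ℝ} {β b : Fin p → ℝ} {S : Finset (Fin q)}

/-- First-order optimality of a restricted minimizer, in subgradient form. -/
theorem IsRestrictedMin.subgradient (hn : 0 < n) (hlam : 0 < lam)
    (hb : d.IsRestrictedMin lam Y S b) {h : Fin p → ℝ} (hh : h ∈ d.supportedOn S) :
    √(n : ℝ) * ((Y - d.X.mulVec b) ⬝ᵥ d.X.mulVec h) ≤
      l2 (Y - d.X.mulVec b) * (lam *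
        (d.groupNorm Finset.univ (b + h) - d.groupNorm Finset.univ b)) := by
  have hR := Real.sqrt_nonneg (n : ℝ)
  set e := Y - d.X.mulVec b with he
  set D := e ⬝ᵥ d.X.mulVec h with hD
  set x := l2 (d.X.mulVec h)
  have hr := l2_nonneg e
  -- Compare `b` with `b + s h`: convexity bounds the penalty, and `2‖e‖y ≤ ‖e‖² + y²` replaces the
  -- residual norm by its square. Division by `s` leaves an error of order `s`. No differentiability
  -- is used, so a zero residual is allowed.
  have key : ∀ s : ℝ, 0 < s → s ≤ 1 → 2 * √(n : ℝ) * D ≤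
      2 * l2 e * (lam * (d.groupNorm Finset.univ (b + h) - d.groupNorm Finset.univ b))
        + s * (√(n : ℝ) * x ^ 2) := by
    intro s hs0 hs1
    have h1 := (d.criterion_le_iff hn _ _ _ _).1
      (hb.2 (b + s • h) (d.add_mem_supportedOn hb.1 (d.smul_mem_supportedOn s hh)))
    rw [Matrix.mulVec_add, ← sub_sub, ← he] at h1
    have h2 := d.l2_sub_mulVec_sq e (s • h)
    rw [Matrix.mulVec_smul, dotProduct_smul, l2_smul, abs_of_pos hs0, smul_eq_mul, ← hD] at h2
    rw [Matrix.mulVec_smul] at h1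
    have h3 : d.groupNorm Finset.univ (b + s • h) ≤ (1 - s) * d.groupNorm Finset.univ b
        + s * d.groupNorm Finset.univ (b + h) := by
      have h4 := d.groupNorm_add_le Finset.univ ((1 - s) • b) (s • (b + h))
      rw [groupNorm_smul, groupNorm_smul, abs_of_pos hs0, abs_of_nonneg (by linarith),
        show (1 - s) • b + s • (b + h) = b + s • h by module] at h4
      exact h4
    set y := l2 (e - s • d.X.mulVec h)
    have h5 : 2 * l2 e * y ≤ 2 * l2 e ^ 2 - 2 * (s * D) + (s * x) ^ 2 := by
      nlinarith [sq_nonneg (l2 e - y)]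
    have h6 := mul_le_mul_of_nonneg_left h3 hlam.le
    have h7 := mul_le_mul_of_nonneg_left (h1.trans (add_le_add_right h6 (√(n : ℝ) * y)))
      (show 0 ≤ 2 * l2 e by positivity)
    have h8 := mul_le_mul_of_nonneg_left h5 hR
    refine le_of_mul_le_mul_left ?_ hs0
    linarith
  by_contra! hlt
  set m := 2 * √(n : ℝ) * D -
    2 * l2 e * (lam * (d.groupNorm Finset.univ (b + h) - d.groupNorm Finset.univ b)) with hm
  have hm0 : 0 < m := by linarith
  set K := √(n : ℝ) * x ^ 2 with hK
  have hK0 : 0 ≤ K := by positivity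
  -- Instead of letting `s` tend to zero, this step size makes the error `mK/(m + K)`, strictly less
  -- than the assumed violation `m`.
  have h1 := key (m / (m + K)) (by positivity) ((div_le_one (by positivity)).2 (by linarith))
  have h2 : m ≤ m / (m + K) * K := by linarith
  rw [div_mul_eq_mul_div, le_div_iff₀ (by positivity)] at h2
  nlinarith

theorem dotProduct_mulVec_eq_sum_block (d : Design n p q) (e : Fin n → ℝ) (h : Fin p → ℝ) :
    e ⬝ᵥ d.X.mulVec h
      = ∑ j, block d.label (d.X.transpose.mulVec e) j ⬝ᵥ block d.label h j := by
  rw [Matrix.dotProduct_mulVec, ← Matrix.mulVec_transpose, dotProduct_eq_sum_block d.label]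

/-- Test the first-order condition in the direction of the score itself, restricted to group `j`:
the left side becomes the squared block norm and the penalty grows by at most `√T_j` times the block
norm. -/
theorem IsRestrictedMin.l2_score_le (hn : 0 < n) (hlam : 0 < lam)
    (hb : d.IsRestrictedMin lam Y S b) {j : Fin q} (hj : j ∈ S) :
    √(n : ℝ) * l2 (block d.label (d.X.transpose.mulVec (Y - d.X.mulVec b)) j)
      ≤ lam * (√(d.T j : ℝ) * l2 (Y - d.X.mulVec b)) := by
  set e := Y - d.X.mulVec b with he
  set g := d.X.transpose.mulVec e with hg
  have hsub : d.restrict {j} g ∈ d.supportedOn S := fun i hi =>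
    d.block_restrict_of_notMem (fun h => hi (by rwa [Finset.mem_singleton.1 h])) g
  have h1 := hb.subgradient hn hlam hsub
  have h2 := d.groupNorm_add_le Finset.univ b (d.restrict {j} g)
  rw [d.groupNorm_restrict, groupNorm, groupNorm, groupNorm, Finset.sum_singleton] at h2
  have h3 : e ⬝ᵥ d.X.mulVec (d.restrict {j} g) = l2 (block d.label g j) ^ 2 := by
    rw [dotProduct_mulVec_eq_sum_block, Finset.sum_eq_single j]
    · rw [d.block_restrict_of_mem (Finset.mem_singleton_self j), l2_sq_eq_dotProduct]
    · intro i _ hij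
      rw [d.block_restrict_of_notMem (by simpa using hij), dotProduct_zero]
    · simp
  rw [← he, h3] at h1
  have hr := l2_nonneg e
  have hy := l2_nonneg (block d.label g j)
  have h4 : d.groupNorm Finset.univ (b + d.restrict {j} g) - d.groupNorm Finset.univ b
      ≤ √(d.T j : ℝ) * l2 (block d.label g j) := by
    unfold groupNorm
    linarith
  have h5 := mul_le_mul_of_nonneg_left h4 (mul_nonneg hr hlam.le)
  rcases hy.eq_or_lt with hy0 | hy0
  · rw [← hy0]
    have : 0 ≤ lam * (√(d.T j : ℝ) * l2 e) := by positivity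
    linarith
  · refine le_of_mul_le_mul_right ?_ hy0
    nlinarith

/-- Split `b - b'` into a part on `S`, handled by optimality of `b'`, and a part outside, handled by
minimality of `b`. What remains is a nonpositive sum over `j ∉ S` of nonnegative terms, each a
strictly positive slack times `‖b^j‖`. Hence all blocks vanish, with no uniqueness of minimizers
required. -/
theorem IsEstimator.mem_supportedOn (hn : 0 < n) (hlam : 0 < lam) {b' : Fin p → ℝ}
    (hb' : d.IsRestrictedMin lam Y S b') (hr : 0 < l2 (Y - d.X.mulVec b'))
    (hstrict : ∀ j ∉ S,
      √(n : ℝ) * l2 (block d.label (d.X.transpose.mulVec (Y - d.X.mulVec b')) j)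
        < lam * (√(d.T j : ℝ) * l2 (Y - d.X.mulVec b')))
    (hb : d.IsEstimator lam Y b) : b ∈ d.supportedOn S := by
  set e := Y - d.X.mulVec b' with he
  set g := d.X.transpose.mulVec e with hg
  set h1 := d.restrict S (b - b') with hh1
  set h2 := d.restrict Sᶜ b with hh2
  have hR := Real.sqrt_nonneg (n : ℝ)
  have e1 : b' + h1 = d.restrict S b := by
    ext k
    by_cases hk : d.label k ∈ S
    · simp [hh1, restrict, hk]
    · simp [hh1, restrict, hk, d.apply_eq_zero_of_mem_supportedOn hb'.1 hk]
  have e2 : b = b' + (h1 + h2) := by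
    rw [← add_assoc, e1, hh2, d.restrict_add_restrict_compl]
  have k1 := (d.criterion_le_iff hn _ _ _ _).1 (hb b')
  have e3 : Y - d.X.mulVec b = e - d.X.mulVec (h1 + h2) := by
    rw [he, e2, Matrix.mulVec_add]
    abel
  rw [e3, ← he] at k1
  have k2 := dotProduct_le_l2_mul_l2 e (e - d.X.mulVec (h1 + h2))
  rw [dotProduct_sub, ← l2_sq_eq_dotProduct, Matrix.mulVec_add, dotProduct_add,
    ← Matrix.mulVec_add] at k2
  have k3 := hb'.subgradient hn hlam (d.restrict_mem_supportedOn S (b - b'))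
  rw [← he, ← hh1, e1, d.groupNorm_restrict] at k3
  have k4 : d.groupNorm Finset.univ b = d.groupNorm S b + d.groupNorm Sᶜ b :=
    (d.groupNorm_add_compl S b).symm
  have k5 := mul_le_mul_of_nonneg_left k2 hR
  have k6 := mul_le_mul_of_nonneg_left k1 hr.le
  have k7 : l2 e * lam * d.groupNorm Sᶜ b ≤ √(n : ℝ) * (e ⬝ᵥ d.X.mulVec h2) := by
    rw [k4] at k6
    nlinarith
  have k8 : e ⬝ᵥ d.X.mulVec h2 ≤ ∑ j ∈ Sᶜ, l2 (block d.label g j) * l2 (block d.label b j) := by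
    rw [dotProduct_mulVec_eq_sum_block, ← Finset.sum_add_sum_compl S,
      Finset.sum_eq_zero (s := S) fun j hj => by
        rw [hh2, d.block_restrict_of_notMem (by simpa using hj), dotProduct_zero], zero_add]
    refine Finset.sum_le_sum fun j hj => ?_
    rw [hh2, d.block_restrict_of_mem hj]
    exact dotProduct_le_l2_mul_l2 _ _
  have k9 : ∑ j ∈ Sᶜ, (lam * (√(d.T j : ℝ) * l2 e) - √(n : ℝ) * l2 (block d.label g j))
      * l2 (block d.label b j) ≤ 0 := by
    have k10 := k7.trans (mul_le_mul_of_nonneg_left k8 hR)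
    unfold groupNorm at k10
    rw [Finset.mul_sum, Finset.mul_sum, ← sub_nonpos, ← Finset.sum_sub_distrib] at k10
    refine le_trans (le_of_eq (Finset.sum_congr rfl fun j _ => ?_)) k10
    ring
  have hnn : ∀ j ∈ Sᶜ, 0 ≤ (lam * (√(d.T j : ℝ) * l2 e) - √(n : ℝ) * l2 (block d.label g j))
      * l2 (block d.label b j) := fun j hj =>
    mul_nonneg (sub_pos.2 (hstrict j (Finset.mem_compl.1 hj))).le (l2_nonneg _)
  intro j hj
  have h0 := (Finset.sum_eq_zero_iff_of_nonneg hnn).1 (k9.antisymm (Finset.sum_nonneg hnn)) j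
    (Finset.mem_compl.2 hj)
  exact l2_eq_zero.1 ((mul_eq_zero.1 h0).resolve_left (sub_pos.2 (hstrict j hj)).ne')

theorem IsEstimator.isRestrictedMin (hb : d.IsEstimator lam Y b) (hS : b ∈ d.supportedOn S) :
    d.IsRestrictedMin lam Y S b := ⟨hS, fun b' _ => hb b'⟩

theorem mul_sqrt_sstar_le {κ : ℝ} (hκ : 0 < κ) (hlam : 0 < lam)
    (hs : (d.sstar S : ℝ) < (n : ℝ) ^ 2 * κ ^ 2 / lam ^ 2) :
    lam * √(d.sstar S : ℝ) ≤ κ * n := by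
  refine le_of_sq_le_sq ?_ (by positivity)
  rw [lt_div_iff₀ (by positivity)] at hs
  rw [mul_pow, Real.sq_sqrt (by positivity)]
  linarith

/-- On the noise event, the residual of a vector with the correct support is not much shorter than
the noise. -/
theorem NoiseBound.le_two_mul_residual {B κ γ : ℝ} (hn : 0 < n) (hlam : 0 < lam)
    (hB2 : 2 * B ≤ lam) (hC : d.Compat S κ γ)
    (hs : (d.sstar S : ℝ) < (n : ℝ) ^ 2 * κ ^ 2 / lam ^ 2)
    (hw : d.NoiseBound B w) {δ : Fin p → ℝ} (hδ : δ ∈ d.supportedOn S) :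
    l2 w ≤ 2 * l2 (w - d.X.mulVec δ) := by
  obtain ⟨hκ, hγ, hcomp⟩ := hC
  have hn' : (0 : ℝ) < n := by exact_mod_cast hn
  have hR : 0 < √(n : ℝ) := Real.sqrt_pos.2 hn'
  have hRn : √(n : ℝ) * √(n : ℝ) = n := Real.mul_self_sqrt hn'.le
  have hE := l2_nonneg w
  have hx := l2_nonneg (d.X.mulVec δ)
  have hsq := d.l2_sub_mulVec_sq w δ
  have ha := d.groupNorm_nonneg S δ
  have hcompl : d.groupNorm Sᶜ δ = 0 :=
    d.groupNorm_eq_zero_of_block fun j hj => hδ j (Finset.mem_compl.1 hj)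
  have h1 := hcomp δ (by rw [hcompl]; positivity)
  have h2 := hw.dotProduct_le δ
  rw [← d.groupNorm_add_compl S, hcompl, add_zero] at h2
  have h3 := mul_sqrt_sstar_le hκ hlam hs
  rw [le_div_iff₀ (by positivity)] at h1
  -- Compatibility applies because `δ` has no mass outside `S`. The result is `‖w - Xδ‖² ≥ E² - Ex +
  -- x²`, which is at least `E²/4`.
  have h4 : 2 * (w ⬝ᵥ d.X.mulVec δ) ≤ l2 w * l2 (d.X.mulVec δ) := by
    refine le_of_mul_le_mul_left (a := n * κ) ?_ (by positivity)
    calc n * κ * (2 * (w ⬝ᵥ d.X.mulVec δ))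
        = √(n : ℝ) * √(n : ℝ) * κ * (2 * (w ⬝ᵥ d.X.mulVec δ)) := by rw [hRn]
      _ = 2 * κ * √(n : ℝ) * (√(n : ℝ) * (w ⬝ᵥ d.X.mulVec δ)) := by ring
      _ ≤ 2 * κ * √(n : ℝ) * (B * l2 w * d.groupNorm S δ) :=
          mul_le_mul_of_nonneg_left h2 (by positivity)
      _ = 2 * B * (l2 w * (d.groupNorm S δ * (√(n : ℝ) * κ))) := by ring
      _ ≤ lam * (l2 w * (√(d.sstar S : ℝ) * l2 (d.X.mulVec δ))) := by gcongr
      _ = lam * √(d.sstar S : ℝ) * (l2 w * l2 (d.X.mulVec δ)) := by ring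
      _ ≤ κ * n * (l2 w * l2 (d.X.mulVec δ)) := by gcongr
      _ = _ := by ring
  refine le_of_sq_le_sq ?_ (mul_nonneg zero_le_two (l2_nonneg _))
  rw [mul_pow, hsq]
  nlinarith [sq_nonneg (l2 w - 2 * l2 (d.X.mulVec δ)), sq_nonneg (l2 w)]

theorem sum_inS_eq (d : Design n p q) {f : Fin p → ℝ} (hf : ∀ k, d.label k ∉ S → f k = 0) :
    ∑ l : d.InS S, f l = ∑ l, f l := by
  rw [← Finset.sum_subtype (Finset.univ.filter fun k => d.label k ∈ S) (by simp) f]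
  refine Finset.sum_subset (Finset.subset_univ _) fun k _ hk => hf k ?_
  simpa using hk

theorem transpose_mulVec_residual (d : Design n p q) (hn : 0 < n) (w : Fin n → ℝ)
    {δ : Fin p → ℝ} (hδ : δ ∈ d.supportedOn S) (k : Fin p) :
    d.X.transpose.mulVec (w - d.X.mulVec δ) k
      = d.X.transpose.mulVec w k - n * ∑ l : d.InS S, d.gram k l * δ l := by
  have hn' : (n : ℝ) ≠ 0 := by exact_mod_cast hn.ne'
  rw [sum_inS_eq d (f := fun l => d.gram k l * δ l) fun l hl => by
    rw [d.apply_eq_zero_of_mem_supportedOn hδ hl, mul_zero]]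
  rw [Matrix.mulVec_sub, Pi.sub_apply, Matrix.mulVec_mulVec]
  congr 1
  rw [Finset.mul_sum, Matrix.mulVec, dotProduct]
  refine Finset.sum_congr rfl fun l _ => ?_
  simp only [gram, Matrix.smul_apply, smul_eq_mul]
  field_simp

/-- Equality holds for `j ∈ S`; for the other groups the left block has no coordinates. -/
theorem l2_block_labelS (d : Design n p q) (z : Fin p → ℝ) (j : Fin q) :
    l2 (block (d.labelS S) (fun i : d.InS S => z i) j) ≤ l2 (block d.label z j) := by
  refine le_of_sq_le_sq ?_ (l2_nonneg _)
  rw [l2_sq, l2_sq]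
  by_cases hj : j ∈ S
  · refine le_of_eq (Fintype.sum_bijective
      (fun i : {i : d.InS S // d.labelS S i = j} =>
        (⟨i.1.1, i.2⟩ : {k : Fin p // d.label k = j})) ⟨?_, ?_⟩ _ _ fun i => rfl)
    · intro a b hab
      exact Subtype.ext (Subtype.ext (Subtype.mk.inj hab))
    · rintro ⟨k, hk⟩
      exact ⟨⟨⟨k, hk ▸ hj⟩, hk⟩, rfl⟩
  · have : IsEmpty {i : d.InS S // d.labelS S i = j} := ⟨fun i => hj (i.2 ▸ i.1.2)⟩
    rw [Fintype.sum_empty]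
    positivity

end Design

/-! ### Strict dual feasibility and subset recovery -/

namespace Design

variable {n p q : ℕ} {d : Design n p q} {lam : ℝ} {w : Fin n → ℝ} {β b : Fin p → ℝ}
  {S : Finset (Fin q)}

/-- The scale `(B ‖w‖₂ + λ r) / n^{3/2}` of the estimation error on the true support. -/
def errorScale (n : ℕ) (B lam E r : ℝ) : ℝ := (B * E + lam * r) / (n * √(n : ℝ))

theorem gram11_mulVec (d : Design n p q) (hn : 0 < n) (w : Fin n → ℝ) {δ : Fin p → ℝ}
    (hδ : δ ∈ d.supportedOn S) :
    (d.gram11 S).mulVec (fun l => δ l) = fun k : d.InS S => ((n : ℝ)⁻¹ •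
      (d.X.transpose.mulVec w - d.X.transpose.mulVec (w - d.X.mulVec δ))) k := by
  have hn' : (n : ℝ) ≠ 0 := by exact_mod_cast hn.ne'
  ext k
  rw [Pi.smul_apply, Pi.sub_apply, d.transpose_mulVec_residual hn w hδ, smul_eq_mul]
  simp only [gram11, Matrix.mulVec, dotProduct, Matrix.submatrix_apply]
  field_simp
  ring

/-- On the true support, the estimation error is a scaled image of the group ball under the inverse
Gram matrix. -/
theorem exists_groupBall_error {B : ℝ} (hn : 0 < n) (hlam : 0 < lam) (hB : 0 ≤ B)
    (hG : IsUnit (d.gram11 S)) (hw : d.NoiseBound B w) {δ : Fin p → ℝ}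
    (hδ : δ ∈ d.supportedOn S) (hr : 0 < l2 (w - d.X.mulVec δ))
    (hscore : ∀ j ∈ S, √(n : ℝ) * l2 (block d.label (d.X.transpose.mulVec (w - d.X.mulVec δ)) j)
      ≤ lam * (√(d.T j : ℝ) * l2 (w - d.X.mulVec δ))) :
    ∃ v ∈ d.groupBall S, (fun l : d.InS S => δ l) =
      errorScale n B lam (l2 w) (l2 (w - d.X.mulVec δ)) • (d.gram11 S)⁻¹.mulVec v := by
  have hn' : (0 : ℝ) < n := by exact_mod_cast hn
  have hR : 0 < √(n : ℝ) := Real.sqrt_pos.2 hn'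
  have hE := l2_nonneg w
  set r := l2 (w - d.X.mulVec δ)
  set ρ := errorScale n B lam (l2 w) r with hρ
  have hρ0 : 0 < ρ := by
    rw [hρ, errorScale]
    positivity
  have hdet : IsUnit (d.gram11 S).det := (Matrix.isUnit_iff_isUnit_det _).1 hG
  -- By the normal equations `Σ₁₁δ` is the difference of the noise score and the residual score over
  -- `n`. Their bounds add up to exactly `ρ√T_j`, so rescaling by `ρ⁻¹` lands in the group ball.
  refine ⟨ρ⁻¹ • (d.gram11 S).mulVec (fun l => δ l), fun j => ?_, ?_⟩
  · rw [block_smul, l2_smul, abs_of_pos (inv_pos.2 hρ0), inv_mul_le_iff₀ hρ0,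
      d.gram11_mulVec hn w hδ]
    by_cases hj : j ∈ S
    · refine (d.l2_block_labelS _ j).trans ?_
      rw [block_smul, l2_smul, abs_of_pos (inv_pos.2 hn'), block_sub]
      have h1 := hw j
      have h2 := hscore j hj
      have h3 := l2_sub_le (block d.label (d.X.transpose.mulVec w) j)
        (block d.label (d.X.transpose.mulVec (w - d.X.mulVec δ)) j)
      have h4 := mul_le_mul_of_nonneg_left h3 hR.le
      rw [inv_mul_le_iff₀ hn']
      refine le_of_mul_le_mul_left ?_ hR
      have h5 : √(n : ℝ) * (n * (ρ * √(d.T j : ℝ))) = (B * l2 w + lam * r) * √(d.T j : ℝ) := by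
        rw [hρ, errorScale]
        field_simp
      rw [h5]
      linarith
    · have : IsEmpty {i : d.InS S // d.labelS S i = j} := ⟨fun i => hj (i.2 ▸ i.1.2)⟩
      rw [Subsingleton.elim (block _ _ _) 0, l2_zero]
      positivity
  · rw [Matrix.mulVec_smul, smul_smul, mul_inv_cancel₀ hρ0.ne', one_smul, Matrix.mulVec_mulVec,
      Matrix.nonsing_inv_mul _ hdet, Matrix.one_mulVec]

/-- Strict dual feasibility outside the true support. -/
theorem l2_score_lt {B κ γ η : ℝ} (hn : 0 < n) (hlam : 0 < lam) (hB : 0 ≤ B)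
    (hBη : 2 * B * (1 + η) ≤ lam * (1 - η)) (hC : d.Compat S κ γ) (hI : d.Irrep S η)
    (hs : (d.sstar S : ℝ) < (n : ℝ) ^ 2 * κ ^ 2 / lam ^ 2)
    (hw : d.NoiseBound B w) {δ : Fin p → ℝ} (hδ : δ ∈ d.supportedOn S)
    (hr : 0 < l2 (w - d.X.mulVec δ))
    (hscore : ∀ j ∈ S, √(n : ℝ) * l2 (block d.label (d.X.transpose.mulVec (w - d.X.mulVec δ)) j)
      ≤ lam * (√(d.T j : ℝ) * l2 (w - d.X.mulVec δ))) {j : Fin q} (hj : j ∉ S) :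
    √(n : ℝ) * l2 (block d.label (d.X.transpose.mulVec (w - d.X.mulVec δ)) j)
      < lam * (√(d.T j : ℝ) * l2 (w - d.X.mulVec δ)) := by
  obtain ⟨hη0, hη1, hG, hirr⟩ := hI
  have hn' : (0 : ℝ) < n := by exact_mod_cast hn
  have hR : 0 < √(n : ℝ) := Real.sqrt_pos.2 hn'
  have hT : 0 < √(d.T j : ℝ) := Real.sqrt_pos.2 (by exact_mod_cast d.T_pos j)
  have hE := l2_nonneg w
  have hEr := hw.le_two_mul_residual hn hlam (by nlinarith) hC hs hδ
  obtain ⟨v, hv, hδv⟩ := exists_groupBall_error hn hlam hB hG hw hδ hr hscore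
  have hvj := hirr v hv j
  set r := l2 (w - d.X.mulVec δ)
  set ρ := errorScale n B lam (l2 w) r with hρ
  have hρ0 : 0 < ρ := by
    rw [hρ, errorScale]
    positivity
  have hblock : block d.label (d.X.transpose.mulVec (w - d.X.mulVec δ)) j
      = block d.label (d.X.transpose.mulVec w) j - (n * ρ) •
        block d.label ((d.gram21 S * (d.gram11 S)⁻¹).mulVec v) j := by
    ext ⟨k, hk⟩
    subst hk
    simp only [block, Pi.sub_apply, Pi.smul_apply, smul_eq_mul]
    rw [d.transpose_mulVec_residual hn w hδ, ← Matrix.mulVec_mulVec, mul_assoc]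
    congr 2
    have h1 : (d.gram21 S).mulVec (fun l => δ l) k = ∑ l : d.InS S, d.gram k l * δ l := by
      simp only [Matrix.mulVec, dotProduct, gram21, if_neg hj]
    rw [← h1, hδv, Matrix.mulVec_smul, Pi.smul_apply, smul_eq_mul]
  rw [div_lt_iff₀ hT] at hvj
  rw [hblock]
  have h1 := l2_sub_le (block d.label (d.X.transpose.mulVec w) j)
    ((n * ρ) • block d.label ((d.gram21 S * (d.gram11 S)⁻¹).mulVec v) j)
  rw [l2_smul, abs_of_pos (by positivity)] at h1
  have h2 := hw j
  have h3 : √(n : ℝ) * (n * ρ) = B * l2 w + lam * r := by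
    rw [hρ, errorScale]
    field_simp
  have h4 : 0 < B * l2 w + lam * r := by positivity
  calc _ ≤ √(n : ℝ) * (l2 (block d.label (d.X.transpose.mulVec w) j) + n * ρ *
          l2 (block d.label ((d.gram21 S * (d.gram11 S)⁻¹).mulVec v) j)) :=
        mul_le_mul_of_nonneg_left h1 hR.le
    _ = √(n : ℝ) * l2 (block d.label (d.X.transpose.mulVec w) j) + √(n : ℝ) * (n * ρ) *
          l2 (block d.label ((d.gram21 S * (d.gram11 S)⁻¹).mulVec v) j) := by ring
    _ < B * (√(d.T j : ℝ) * l2 w) + (B * l2 w + lam * r) * (η * √(d.T j : ℝ)) := by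
        rw [h3]
        exact add_lt_add_of_le_of_lt h2 (mul_lt_mul_of_pos_left hvj h4)
    _ = √(d.T j : ℝ) * (B * (1 + η) * l2 w + η * lam * r) := by ring
    _ ≤ √(d.T j : ℝ) * (lam * r) := by
        refine mul_le_mul_of_nonneg_left ?_ hT.le
        -- The factor `2` in `2η̃` is spent here: `‖w‖ ≤ 2r` turns `B(1 + η)‖w‖` into at most `λ(1 -
        -- η)r`.
        have h5 := mul_le_mul_of_nonneg_left hEr (show 0 ≤ B * (1 + η) by positivity)
        have h6 := mul_le_mul_of_nonneg_right hBη hr.le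
        linarith
    _ = _ := by ring

/-- A real supremum of an unbounded set is `0` by convention, so boundedness is needed before `xi`
dominates any of its values. -/
theorem bddAbove_xi (d : Design n p q) (S : Finset (Fin q)) :
    BddAbove {r | ∃ v ∈ d.groupBall S, ∃ j,
      r = linf (block d.label ((d.gram11inv S).mulVec v) j) / √(d.T j : ℝ)} := by
  refine ⟨∑ k, ∑ l, |d.gram11inv S k l| * √(d.T (d.labelS S l) : ℝ), ?_⟩
  rintro r ⟨v, hv, j, rfl⟩
  have hT : 1 ≤ √(d.T j : ℝ) := Real.one_le_sqrt.2 (by exact_mod_cast d.T_pos j)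
  have hv' : ∀ l, |v l| ≤ √(d.T (d.labelS S l) : ℝ) := fun l => by
    refine le_trans ?_ (hv (d.labelS S l))
    simpa [block, l2] using PiLp.norm_apply_le
      (WithLp.toLp 2 (block (d.labelS S) v (d.labelS S l))) ⟨l, rfl⟩
  refine (div_le_self (norm_nonneg _) hT).trans ?_
  refine (pi_norm_le_iff_of_nonneg (by positivity)).2 fun k => ?_
  calc ‖block d.label ((d.gram11inv S).mulVec v) j k‖
      = |∑ l, d.gram11inv S k l * v l| := rfl
    _ ≤ ∑ l, |d.gram11inv S k l * v l| := Finset.abs_sum_le_sum_abs _ _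
    _ ≤ ∑ l, |d.gram11inv S k l| * √(d.T (d.labelS S l) : ℝ) := by
        refine Finset.sum_le_sum fun l _ => ?_
        rw [abs_mul]
        exact mul_le_mul_of_nonneg_left (hv' l) (abs_nonneg _)
    _ ≤ _ := Finset.single_le_sum
        (f := fun k => ∑ l, |d.gram11inv S k l| * √(d.T (d.labelS S l) : ℝ))
        (fun k _ => by positivity) (Finset.mem_univ _)

theorem xi_nonneg (d : Design n p q) (S : Finset (Fin q)) : 0 ≤ d.xi S := by
  refine Real.sSup_nonneg ?_
  rintro r ⟨v, -, j, rfl⟩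
  exact div_nonneg (norm_nonneg _) (Real.sqrt_nonneg _)

theorem linf_block_gram11inv_le {v : d.InS S → ℝ} (hv : v ∈ d.groupBall S) (j : Fin q) :
    linf (block d.label ((d.gram11inv S).mulVec v) j) ≤ d.xi S * √(d.T j : ℝ) := by
  have hT : 0 < √(d.T j : ℝ) := Real.sqrt_pos.2 (by exact_mod_cast d.T_pos j)
  rw [← div_le_iff₀ hT]
  exact le_csSup (d.bddAbove_xi S) ⟨v, hv, j, rfl⟩

theorem eq_smul_gram11inv_mulVec {δ : Fin p → ℝ} (hδ : δ ∈ d.supportedOn S) {ρ : ℝ}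
    {v : d.InS S → ℝ} (h : (fun l : d.InS S => δ l) = ρ • (d.gram11 S)⁻¹.mulVec v) :
    δ = ρ • (d.gram11inv S).mulVec v := by
  ext k
  by_cases hk : d.label k ∈ S
  · rw [show δ k = (fun l : d.InS S => δ l) ⟨k, hk⟩ from rfl, h]
    simp only [Pi.smul_apply, Matrix.mulVec, dotProduct, gram11inv, dif_pos hk]
  · rw [d.apply_eq_zero_of_mem_supportedOn hδ hk]
    simp [Matrix.mulVec, dotProduct, gram11inv, hk]

theorem IsEstimator.subsetRecovery {B κ γ η α σ : ℝ} {e : Fin n → ℝ} (hn : 0 < n)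
    (hlam : 0 < lam) (hB : 0 ≤ B) (hσ : 0 ≤ σ) (hα : 0 ≤ tdev n α)
    (hC : d.Compat (d.active β) κ γ) (hI : d.Irrep (d.active β) η)
    (hBγ : B * (γ + 1) ≤ lam * (γ - 1)) (hBη : 2 * B * (1 + η) ≤ lam * (1 - η))
    (hs : (d.sstar (d.active β) : ℝ) < (n : ℝ) ^ 2 * κ ^ 2 / lam ^ 2)
    (hw : d.NoiseBound B (σ • e)) (he : l2 e ≤ √(n : ℝ) * √(1 + tdev n α))
    (hb : d.IsEstimator lam (d.response β σ e) b) :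
    d.SubsetRecovery α κ γ η σ lam β b := by
  have hn' : (0 : ℝ) < n := by exact_mod_cast hn
  have hR : 0 < √(n : ℝ) := Real.sqrt_pos.2 hn'
  have hκ := hC.1
  have hγ := hC.2.1
  have hη0 := hI.1
  have hη1 := hI.2.1
  have hu := u_nonneg hn hκ hγ hlam hs
  have hξ := d.xi_nonneg (d.active β)
  have hA : 0 < √(1 + tdev n α) := Real.sqrt_pos.2 (by linarith)
  set w := σ • e with hwdef
  have hb' : d.IsEstimator lam (d.X.mulVec β + w) b := hb
  have hD0 : 0 ≤ d.recoveryConst (d.active β) α κ γ η lam := by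
    unfold recoveryConst
    positivity
  -- Without noise the estimation bound forces `b = β`; otherwise residuals on the true support are
  -- nonzero, as the dual argument requires.
  rcases (l2_nonneg w).eq_or_lt with h0 | h0
  · have h1 := hb'.groupNorm_le hn hlam hB hC hBγ hs hw
    rw [← h0, zero_div, mul_zero] at h1
    have h2 : b = β := sub_eq_zero.1 (d.eq_zero_of_groupNorm_le h1)
    subst h2
    refine ⟨fun j hj => d.block_eq_zero_of_notMem_active hj, fun j => ?_, fun _ => rfl⟩
    rw [sub_self, block_zero, linf, norm_zero]
    positivity
  have hE : l2 w ≤ σ * (√(n : ℝ) * √(1 + tdev n α)) := by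
    rw [hwdef, l2_smul, abs_of_nonneg hσ]
    exact mul_le_mul_of_nonneg_left he hσ
  have hσ0 : 0 < σ := by
    refine hσ.lt_of_ne fun h => ?_
    rw [← h, zero_mul] at hE
    linarith
  have hβS := d.mem_supportedOn_active β
  obtain ⟨b₀, hb₀⟩ : ∃ b₀, d.IsRestrictedMin lam (d.X.mulVec β + w) (d.active β) b₀ :=
    d.exists_isMinOn_criterion hn hlam _ (d.isClosed_supportedOn _) (d.zero_mem_supportedOn _)
  have hres : ∀ {c}, c ∈ d.supportedOn (d.active β) → 0 < l2 (w - d.X.mulVec (c - β)) := by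
    intro c hc
    have := hw.le_two_mul_residual hn hlam (by nlinarith) hC hs
      (d.sub_mem_supportedOn hc hβS)
    linarith
  have hbS : b ∈ d.supportedOn (d.active β) := by
    refine hb'.mem_supportedOn hn hlam hb₀ ?_ fun j hj => ?_
    · rw [residual_eq]
      exact hres hb₀.1
    · have hscore := fun i (hi : i ∈ d.active β) => hb₀.l2_score_le hn hlam hi
      rw [residual_eq] at hscore ⊢
      exact l2_score_lt hn hlam hB hBη hC hI hs hw (d.sub_mem_supportedOn hb₀.1 hβS)
        (hres hb₀.1) hscore hj
  have hδS := d.sub_mem_supportedOn hbS hβS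
  have hscore := fun i (hi : i ∈ d.active β) => (hb'.isRestrictedMin hbS).l2_score_le hn hlam hi
  rw [residual_eq] at hscore
  obtain ⟨v, hv, hδv⟩ := exists_groupBall_error hn hlam hB hI.2.2.1 hw hδS (hres hbS) hscore
  have hx := hb'.l2_mulVec_le hn hlam hB hC hBγ hs hw
  have hr := l2_sub_le w (d.X.mulVec (b - β))
  set r := l2 (w - d.X.mulVec (b - β))
  set ρ := errorScale n B lam (l2 w) r with hρ
  set u := d.u (d.active β) κ γ lam with hudef
  have hδeq := eq_smul_gram11inv_mulVec hδS hδv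
  have hr0 : 0 < r := hres hbS
  have hρ0 : 0 < ρ := by
    rw [hρ, errorScale]
    positivity
  set ρmax := 2 * √(1 + tdev n α) * (1 + u) / (1 + η) * (σ * lam / n) with hρmax
  -- From `r ≤ (1 + u)‖w‖` and `B ≤ λ(1 - η)/(2(1 + η))`. The spare amount `λ‖w‖(1 - η)(1/2 + u)`
  -- makes the inequality strict, so a non-strict Beta Min threshold suffices.
  have hρlt : ρ < ρmax := by
    have h1 : r ≤ (1 + u) * l2 w := by
      have h2 : lam * √(d.sstar (d.active β) : ℝ) / (κ * n) ≤ 1 :=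
        div_le_one_of_le₀ (mul_sqrt_sstar_le hκ hlam hs) (by positivity)
      have h3 := mul_le_mul_of_nonneg_right (mul_le_mul_of_nonneg_left h2 hu) h0.le
      linarith
    have h4 : (1 + η) * (B * l2 w + lam * r) < 2 * (1 + u) * lam * l2 w := by
      have h5 := mul_le_mul_of_nonneg_right hBη h0.le
      have h6 := mul_le_mul_of_nonneg_left h1 (show 0 ≤ (1 + η) * lam by positivity)
      have h7 : 0 < lam * l2 w * ((1 - η) * (1 + 2 * u)) :=
        mul_pos (by positivity) (mul_pos (by linarith) (by linarith))
      nlinarith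
    rw [hρ, errorScale, hρmax]
    calc (B * l2 w + lam * r) / (n * √(n : ℝ))
        < (2 * (1 + u) * lam * l2 w / (1 + η)) / (n * √(n : ℝ)) := by
          refine div_lt_div_of_pos_right ?_ (by positivity)
          rw [lt_div_iff₀ (by positivity)]
          linarith
      _ ≤ (2 * (1 + u) * lam * (σ * (√(n : ℝ) * √(1 + tdev n α))) / (1 + η))
          / (n * √(n : ℝ)) := by gcongr
      _ = _ := by field_simp
  have hlinf : ∀ j, linf (block d.label (b - β) j) ≤ ρ * (d.xi (d.active β) * √(d.T j : ℝ)) := by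
    intro j
    rw [hδeq, block_smul, linf, norm_smul, Real.norm_of_nonneg hρ0.le]
    exact mul_le_mul_of_nonneg_left (linf_block_gram11inv_le hv j) hρ0.le
  have hconst : ∀ j, d.recoveryConst (d.active β) α κ γ η lam * (√(d.T j : ℝ) * σ * lam / n)
      = ρmax * (d.xi (d.active β) * √(d.T j : ℝ)) := by
    intro j
    rw [hρmax, recoveryConst]
    ring
  refine ⟨hbS, fun j => ?_, ?_⟩
  · rw [hconst]
    exact (hlinf j).trans (mul_le_mul_of_nonneg_right hρlt.le (by positivity))
  · rintro ⟨m, hm, hmD⟩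
    ext j
    refine ⟨fun hj => by_contra fun h => d.mem_active.1 hj (hbS j h), fun hj => ?_⟩
    have hT : 0 < √(d.T j : ℝ) := Real.sqrt_pos.2 (by exact_mod_cast d.T_pos j)
    rw [mem_active]
    -- If `b^j = 0`, the error block is `-β^j`, so `‖β^j‖_∞` would lie strictly below its own
    -- threshold. Strictness needs a positive `ξ`, which follows from `β^j ≠ 0`.
    intro hbj
    have h1 := hmD j hj
    rw [hconst] at h1
    have h2 : linf (block d.label β j) ≤ ρ * (d.xi (d.active β) * √(d.T j : ℝ)) := by
      have h3 := hlinf j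
      rwa [block_sub, hbj, zero_sub, linf, norm_neg] at h3
    have h4 : 0 < linf (block d.label β j) := norm_pos_iff.2 (d.mem_active.1 hj)
    have h5 : 0 < d.xi (d.active β) * √(d.T j : ℝ) :=
      pos_of_mul_pos_right (h4.trans_le h2) hρ0.le
    have h6 := mul_lt_mul_of_pos_right hρlt h5
    have h7 := hm j hj
    linarith

end Design

/-! ### Order of magnitude of the tuning parameter -/

namespace Design

variable {n p q : ℕ}

/-- The smallest tuning parameter has order `√(n / T_min) log q`. -/
theorem exists_tuning_le {α : ℝ} (hα0 : 0 < α) (hα1 : α < 1) {c : ℝ} (hc : 0 ≤ c) (M : ℝ) :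
    ∃ C : ℝ, ∀ {n p q : ℕ} (d : Design n p q), 2 ≤ q → (∀ j, d.T j < n) → d.zeta ≤ M →
      (n : ℝ) ≤ M * ((n : ℝ) - d.Tmax) → (d.Tmin : ℝ) ≤ M * Real.log q ^ 2 →
      d.tuning c α ≤ C * (√((n : ℝ) / d.Tmin) * Real.log q) := by
  set K := 1 + Real.log (2 / α) / Real.log 2 with hK
  have hlog2 : 0 < Real.log 2 := Real.log_pos (by norm_num)
  have hlogα : 0 ≤ Real.log (2 / α) := Real.log_nonneg (by rw [le_div_iff₀ hα0]; linarith)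
  refine ⟨√(2 * M) * √M * c * (√M + √(2 * K / Real.log 2)), ?_⟩
  intro n p q d hq hT hζ hTmax hTmin
  have hq0 : 0 < q := by omega
  have hn : 0 < n := Nat.zero_lt_of_lt (hT ⟨0, hq0⟩)
  have hn' : (0 : ℝ) < n := by exact_mod_cast hn
  have hq' : (2 : ℝ) ≤ q := by exact_mod_cast hq
  have hN : (0 : ℝ) < n - d.Tmax := sub_pos.2 (by exact_mod_cast d.Tmax_lt hq0 hT)
  have hζ1 := d.one_le_zeta hq0 hn
  have hM : 0 < M := by linarith
  have hTm : (0 : ℝ) < d.Tmin := by exact_mod_cast d.Tmin_pos hq0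
  have hlq : Real.log 2 ≤ Real.log q := Real.log_le_log (by norm_num) hq'
  set l := Real.log q with hl
  have hl0 : 0 < l := hlog2.trans_le hlq
  have hK0 : 0 ≤ K := by positivity
  have h1 : n / √((n : ℝ) - d.Tmax) ≤ √(n : ℝ) * √M := by
    rw [div_le_iff₀ (Real.sqrt_pos.2 hN), mul_assoc, ← Real.sqrt_mul hM.le]
    calc (n : ℝ) = √(n : ℝ) * √(n : ℝ) := (Real.mul_self_sqrt hn'.le).symm
      _ ≤ _ := by gcongr
  -- The upper bound on `T_min` is what lets the summand `1` of the tuning parameter be absorbed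
  -- into `log q / √T_min`.
  have h2 : 1 ≤ √M * l / √(d.Tmin : ℝ) := by
    rw [one_le_div (Real.sqrt_pos.2 hTm)]
    calc √(d.Tmin : ℝ) ≤ √(M * l ^ 2) := Real.sqrt_le_sqrt hTmin
      _ = √M * l := by rw [Real.sqrt_mul hM.le, Real.sqrt_sq hl0.le]
  have h3 : Real.log (2 * q / α) ≤ K * (l ^ 2 / Real.log 2) := by
    have e1 : Real.log (2 * q / α) = l + Real.log (2 / α) := by
      rw [hl, ← Real.log_mul (by positivity) (by positivity)]
      congr 1
      ring
    have e2 : Real.log (2 / α) ≤ Real.log (2 / α) / Real.log 2 * l := by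
      rw [div_mul_eq_mul_div, le_div_iff₀ hlog2]
      exact mul_le_mul_of_nonneg_left hlq hlogα
    -- Since `q ≥ 2`, `log q` is bounded below by `log 2`, which allows trading `log q` for its
    -- square before taking the root.
    have e3 : l ≤ l ^ 2 / Real.log 2 := by
      rw [le_div_iff₀ hlog2]
      nlinarith
    rw [e1]
    calc l + Real.log (2 / α) ≤ K * l := by rw [hK]; linarith
      _ ≤ _ := mul_le_mul_of_nonneg_left e3 hK0
  have h4 : √(2 * Real.log (2 * q / α) / d.Tmin) ≤ √(2 * K / Real.log 2) * l / √(d.Tmin : ℝ) := by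
    rw [Real.sqrt_div' _ hTm.le]
    gcongr
    calc √(2 * Real.log (2 * q / α)) ≤ √(2 * K / Real.log 2 * l ^ 2) := by
          apply Real.sqrt_le_sqrt
          calc _ ≤ 2 * (K * (l ^ 2 / Real.log 2)) := by linarith
            _ = _ := by ring
      _ = _ := by rw [Real.sqrt_mul (by positivity), Real.sqrt_sq hl0.le]
  unfold tuning
  calc √(2 * d.zeta) * n * c / √((n : ℝ) - d.Tmax) * (1 + √(2 * Real.log (2 * q / α) / d.Tmin))
      = √(2 * d.zeta) * c * (n / √((n : ℝ) - d.Tmax)) *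
        (1 + √(2 * Real.log (2 * q / α) / d.Tmin)) := by ring
    _ ≤ √(2 * M) * c * (√(n : ℝ) * √M) *
        (√M * l / √(d.Tmin : ℝ) + √(2 * K / Real.log 2) * l / √(d.Tmin : ℝ)) := by gcongr
    _ = _ := by
        rw [Real.sqrt_div hn'.le]
        ring

theorem lam_pos {d : Design n p q} {α lam c : ℝ} (hq : 0 < q) (hT : ∀ j, d.T j < n) (hc : 0 < c)
    (hlam : d.tuning c α ≤ lam) : 0 < lam := by
  rw [d.tuning_eq_mul] at hlam
  exact (mul_pos hc (d.tuning_one_pos hq hT)).trans_le hlam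

end Design

theorem div_mul_gamma_le {lam γ c : ℝ} (hlam : 0 < lam) (hγ : 1 < γ) (hc : gammaBar γ ≤ c) :
    lam / c * (γ + 1) ≤ lam * (γ - 1) := by
  have h0 : 0 < c := by linarith [gammaBar_gt_one hγ]
  unfold gammaBar at hc
  rw [div_le_iff₀ (by linarith)] at hc
  rw [div_mul_eq_mul_div, div_le_iff₀ h0]
  nlinarith

theorem div_mul_eta_le {lam η c : ℝ} (hlam : 0 < lam) (hη0 : 0 < η) (hη1 : η < 1)
    (hc : 2 * etaTilde η ≤ c) : 2 * (lam / c) * (1 + η) ≤ lam * (1 - η) := by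
  have h1 : 0 < 1 - η := by linarith
  have h0 : 0 < c := lt_of_lt_of_le (by unfold etaTilde; positivity) hc
  unfold etaTilde at hc
  rw [← mul_div_assoc, div_le_iff₀ h1] at hc
  have : 2 * (lam / c) * (1 + η) = lam * (2 * (1 + η)) / c := by ring
  rw [this, div_le_iff₀ h0]
  nlinarith

theorem le_sqrt_mul_sqrt_of_sq_le {n : ℕ} {x y : ℝ} (h : x ^ 2 ≤ n * y) :
    x ≤ √(n : ℝ) * √y := by
  rw [← Real.sqrt_mul (by positivity)]
  exact Real.le_sqrt_of_sq_le h

end GSRL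

end

theorem corollary2p1 (α : ℝ) (hα0 : 0 < α) (hα1 : α < 1) :
    (∀ {n p q : ℕ} (d : GSRL.Design n p q) (β : Fin p → ℝ) (σ : ℝ)
        {Ω : Type*} [MeasurableSpace Ω] (P : MeasureTheory.Measure Ω)
        [MeasureTheory.IsProbabilityMeasure P] (ε : Fin n → Ω → ℝ),
      0 < q → 0 ≤ σ →
      (∀ i, Measurable (ε i)) →
      (∀ i, P.map (ε i) = ProbabilityTheory.gaussianReal 0 1) →
      ProbabilityTheory.iIndepFun ε P →
      (∀ j, d.T j < n) →
      16 * Real.log (2 * q / α) ≤ (n : ℝ) - d.Tmax →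
      -- the constant `√(1 + t)` of the bounds below is absolutely bounded
      GSRL.tdev n α ≤ 3 / 4 ∧
      -- probability of the event `V ≤ λ / γ̄`
      (∀ γ lam : ℝ, 1 < γ → d.tuning (GSRL.gammaBar γ) α ≤ lam →
        1 - α ≤ P.real {ω | d.V (fun i => ε i ω) ≤ lam / GSRL.gammaBar γ}) ∧
      -- probability of the event `V ≤ λ / (γ̄ ∨ 2η̃)`
      (∀ γ η lam : ℝ, 1 < γ → 0 < η → η < 1 →
        d.tuning (max (GSRL.gammaBar γ) (2 * GSRL.etaTilde η)) α ≤ lam →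
        1 - α ≤ P.real {ω | d.V (fun i => ε i ω) ≤
          lam / max (GSRL.gammaBar γ) (2 * GSRL.etaTilde η)}) ∧
      -- prediction and estimation
      (∀ κ γ lam : ℝ, d.Compat (d.active β) κ γ →
        (d.sstar (d.active β) : ℝ) < (n : ℝ) ^ 2 * κ ^ 2 / lam ^ 2 →
        d.tuning (GSRL.gammaBar γ) α ≤ lam →
        (∀ ω, ∃ b, d.IsEstimator lam (d.response β σ (fun i => ε i ω)) b) ∧
        GSRL.WithProb P (1 - 2 * α) fun ω =>
          ∀ b, d.IsEstimator lam (d.response β σ (fun i => ε i ω)) b →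
            d.PredictionBounds α κ γ σ lam β b) ∧
      -- subset recovery
      (∀ κ γ η lam : ℝ, d.Compat (d.active β) κ γ → d.Irrep (d.active β) η →
        (d.sstar (d.active β) : ℝ) < (n : ℝ) ^ 2 * κ ^ 2 / lam ^ 2 →
        d.tuning (max (GSRL.gammaBar γ) (2 * GSRL.etaTilde η)) α ≤ lam →
        (∀ ω, ∃ b, d.IsEstimator lam (d.response β σ (fun i => ε i ω)) b) ∧
        GSRL.WithProb P (1 - 2 * α) fun ω =>
          ∀ b, d.IsEstimator lam (d.response β σ (fun i => ε i ω)) b →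
            d.SubsetRecovery α κ γ η σ lam β b)) ∧
    -- order of magnitude of the smallest tuning parameter allowed for prediction and estimation
    (∀ γ M : ℝ, 1 < γ → ∃ C : ℝ, ∀ {n p q : ℕ} (d : GSRL.Design n p q),
      2 ≤ q → (∀ j, d.T j < n) →
      d.zeta ≤ M → (n : ℝ) ≤ M * ((n : ℝ) - d.Tmax) → (d.Tmin : ℝ) ≤ M * Real.log q ^ 2 →
      d.tuning (GSRL.gammaBar γ) α ≤ C * (√((n : ℝ) / d.Tmin) * Real.log q)) ∧
    -- order of magnitude of the smallest tuning parameter allowed for subset recovery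
    (∀ γ η M : ℝ, 1 < γ → 0 < η → η < 1 → ∃ C : ℝ, ∀ {n p q : ℕ} (d : GSRL.Design n p q),
      2 ≤ q → (∀ j, d.T j < n) →
      d.zeta ≤ M → (n : ℝ) ≤ M * ((n : ℝ) - d.Tmax) → (d.Tmin : ℝ) ≤ M * Real.log q ^ 2 →
      d.tuning (max (GSRL.gammaBar γ) (2 * GSRL.etaTilde η)) α ≤
        C * (√((n : ℝ) / d.Tmin) * Real.log q)) := by
  have hmax : ∀ γ η : ℝ, 1 < γ → 0 < max (GSRL.gammaBar γ) (2 * GSRL.etaTilde η) := fun γ η hγ =>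
    lt_max_of_lt_left (one_pos.trans (GSRL.gammaBar_gt_one hγ))
  refine ⟨?_, fun γ M hγ => GSRL.Design.exists_tuning_le hα0 hα1
    (one_pos.trans (GSRL.gammaBar_gt_one hγ)).le M, fun γ η M hγ _ _ =>
    GSRL.Design.exists_tuning_le hα0 hα1 (hmax γ η hγ).le M⟩
  intro n p q d β σ Ω _ P _ ε hq hσ hm hg hi hT hlog
  have hn : 0 < n := Nat.zero_lt_of_lt (hT ⟨0, hq⟩)
  refine ⟨GSRL.tdev_le hn ?_, fun γ lam hγ hlam => d.real_V_le_ge hm hg hi hq hα0 hα1 hT hlog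
      (one_pos.trans (GSRL.gammaBar_gt_one hγ)) hlam,
    fun γ η lam hγ _ _ hlam => d.real_V_le_ge hm hg hi hq hα0 hα1 hT hlog (hmax γ η hγ) hlam,
    fun κ γ lam hC hs hlam => ?_, fun κ γ η lam hC hI hs hlam => ?_⟩
  · have h1 : Real.log (1 / α) ≤ Real.log (2 * q / α) := by
      have hq' : (1 : ℝ) ≤ q := by exact_mod_cast hq
      refine Real.log_le_log (by positivity) ?_
      gcongr
      linarith
    have : (0 : ℝ) ≤ d.Tmax := by positivity
    linarith
  · have hc := one_pos.trans (GSRL.gammaBar_gt_one hC.2.1)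
    have hlam0 := GSRL.Design.lam_pos hq hT hc hlam
    exact ⟨fun ω => d.exists_isEstimator hn hlam0 _,
      d.withProb_of_V_le_of_noise_level hm hg hi hq hα0 hα1 hT hlog hc hlam fun ω hV hN b hb =>
        hb.predictionBounds hn hlam0 (by positivity) hσ hC
          (GSRL.div_mul_gamma_le hlam0 hC.2.1 le_rfl) hs (.of_V_le hV)
          (GSRL.le_sqrt_mul_sqrt_of_sq_le hN)⟩
  · have hc := hmax γ η hC.2.1
    have hlam0 := GSRL.Design.lam_pos hq hT hc hlam
    exact ⟨fun ω => d.exists_isEstimator hn hlam0 _,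
      d.withProb_of_V_le_of_noise_level hm hg hi hq hα0 hα1 hT hlog hc hlam fun ω hV hN b hb =>
        hb.subsetRecovery hn hlam0 (by positivity) hσ (GSRL.tdev_nonneg hα0 hα1) hC hI
          (GSRL.div_mul_gamma_le hlam0 hC.2.1 (le_max_left _ _))
          (GSRL.div_mul_eta_le hlam0 hI.1 hI.2.1 (le_max_right _ _)) hs (.of_V_le hV)
          (GSRL.le_sqrt_mul_sqrt_of_sq_le hN)⟩
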